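/- Let $\mathbb H$ be the real quaternions with imaginary units $\mathbf e_1,\mathbf e_2,\mathbf e_3$ ($\mathbf e_1\mathbf e_2=\mathbf e_3$), and write $x=x_0+x_1\mathbf e_1+x_2\mathbf e_2+x_3\mathbf e_3$. Let $\mathcal O_{\mathbb H}$ be the set of (germs at $0$ of) functions $f:\mathbb H\to\mathbb H$ that are left-hyperholomorphic in a neighbourhood of the origin, i.e. real-differentiable there with $$\frac{\partial f}{\partial x_0}+\sum_{k=1}^3\mathbf e_k\frac{\partial f}{\partial x_k}=0 .$$ Put $\zeta_k(x)=x_k-x_0\mathbf e_k$ for $k=1,2,3$. For $\nu\in\mathbb Z_+^3$ let $\zeta^\nu$ be the Fueter polynomial $\zeta_1^{\times\nu_1}\times\zeta_2^{\times\nu_2}\times\zeta_3^{\times\nu_3}$, where $a_1\times\cdots\times a_N=\frac1{N!}\sum_{\sigma\in S_N}a_{\sigma(1)}\cdots a_{\sigma(N)}$ is the symmetrized product, and let $f_\nu=\frac1{\nu!}\frac{\partial^{|\nu|}f}{\partial x_1^{\nu_1}\partial x_2^{\nu_2}\partial x_3^{\nu_3}}(0)$. Every $f\in\mathcal O_{\mathbb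 H}$ has the expansion $f=\sum_\nu\zeta^\nu f_\nu$ near $0$, and $\mathcal O_{\mathbb H}$ is a ring for the usual addition and the Cauchy–Kovalevskaya (C-K) product $$f\odot g=\sum_{\eta\in\mathbb Z_+^3}\zeta^\eta\sum_{0\le\nu\le\eta}f_\nu\,g_{\eta-\nu},$$ which extends to matrices over $\mathcal O_{\mathbb H}$ in the usual way; $F^{-\odot}$ denotes the two-sided inverse for $\odot$ of a square matrix $F$ over $\mathcal O_{\mathbb H}$. Let $\mathcal Q_{\mathbb H}$ be the smallest subring of $\mathcal O_{\mathbb H}$ that contains all left-hyperholomorphic $\mathbb H$-valued polynomials in $x_0,x_1,x_2,x_3$ and is closed under C-K inversion: if $r\in\mathcal Q_{\mathbb H}$ and $r(0)\ne0$, then $r^{-\odot}$ exists and lies in $\mathcal Q_{\mathbb H}$. Let $R$ be an $\mathbb H^{m\times n}$-valued function, left-hyperholomorphic in a neighbourhood of the origin. Then all entries of $R$ belong to $\mathcal Q_{\mathbb H}$ if and only if there are an $\ell\ge0$ and constant quaternionic matrices $A_k\in\mathbb H^{\ell\times\ell}$, $B_k\in\mathbb H^{\ell\times n}$ ($k=1,2,3$),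 $C\in\mathbb H^{m\times\ell}$, $D\in\mathbb H^{m\times n}$ such that, near the origin, $$R=D+C\odot\bigl(I_\ell-\zeta_1A_1-\zeta_2A_2-\zeta_3A_3\bigr)^{-\odot}\odot(\zeta_1B_1+\zeta_2B_2+\zeta_3B_3).$$ -/

import Mathlib

open scoped Quaternion Topology Nat

noncomputable section

namespace Hyperholomorphic

/-- The imaginary units `e₁, e₂, e₃` (indexed by `0, 1, 2`). -/
def e : Fin 3 → ℍ[ℝ] := ![⟨0, 1, 0, 0⟩, ⟨0, 0, 1, 0⟩, ⟨0, 0, 0, 1⟩]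

/-- The partial derivative `∂f/∂xₙ`, `n = 1, 2, 3`. -/
def pderiv (n : Fin 3) (f : ℍ[ℝ] → ℍ[ℝ]) : ℍ[ℝ] → ℍ[ℝ] := fun x => fderiv ℝ f x (e n)

/-- The (left) Cauchy-Fueter operator
`D f = ∂f/∂x₀ + e₁ ∂f/∂x₁ + e₂ ∂f/∂x₂ + e₃ ∂f/∂x₃`. -/
def cauchyFueter (f : ℍ[ℝ] → ℍ[ℝ]) : ℍ[ℝ] → ℍ[ℝ] :=
  fun x => fderiv ℝ f x 1 + ∑ n, e n * pderiv n f x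

/-- The space of functions left-hyperholomorphic in a neighbourhood of the origin:
real-differentiable there and annihilated by the Cauchy-Fueter operator. Functions are total, and
only their values near the origin matter; equality in this space is `=ᶠ[𝓝 0]`. -/
def HypO : Set (ℍ[ℝ] → ℍ[ℝ]) :=
  {f | ∀ᶠ x in 𝓝 (0 : ℍ[ℝ]), DifferentiableAt ℝ f x ∧ cauchyFueter f x = 0}

/-- The hyperholomorphic variables `ζₙ(x) = xₙ - x₀ eₙ`. -/
def zeta (n : Fin 3) (x : ℍ[ℝ]) : ℍ[ℝ] :=
  ((![x.imI, x.imJ, x.imK] n : ℝ) : ℍ[ℝ]) - (x.re : ℍ[ℝ]) * e n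

/-- The symmetrized product `a₁ × ⋯ × aₙ = (1/n!) ∑_σ a_{σ(1)} ⋯ a_{σ(n)}`. -/
def symProd (l : List ℍ[ℝ]) : ℍ[ℝ] :=
  ((l.length ! : ℝ)⁻¹) •
    ∑ σ : Equiv.Perm (Fin l.length), (List.ofFn fun i => l.get (σ i)).prod

/-- The Fueter polynomial `ζ^ν = ζ₁^{×ν₁} × ζ₂^{×ν₂} × ζ₃^{×ν₃}`. -/
def fueter (ν : Fin 3 →₀ ℕ) (x : ℍ[ℝ]) : ℍ[ℝ] :=
  symProd (List.replicate (ν 0) (zeta 0 x) ++ List.replicate (ν 1) (zeta 1 x) ++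
    List.replicate (ν 2) (zeta 2 x))

/-- The coefficients `f_ν = (1/ν!) (∂^ν f)(0)`, collected in a formal power series. -/
def coeffs (f : ℍ[ℝ] → ℍ[ℝ]) : MvPowerSeries (Fin 3) ℍ[ℝ] := fun ν =>
  (((ν 0)! * (ν 1)! * (ν 2)! : ℝ)⁻¹) •
    ((pderiv 0)^[ν 0] ((pderiv 1)^[ν 1] ((pderiv 2)^[ν 2] f))) 0

/-- The function `∑_ν ζ^ν c_ν`. -/
def fueterSum (c : MvPowerSeries (Fin 3) ℍ[ℝ]) : ℍ[ℝ] → ℍ[ℝ] :=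
  fun x => ∑' ν : Fin 3 →₀ ℕ, fueter ν x * MvPowerSeries.coeff ν c

/-- The Cauchy-Kovalevskaya product
`f ⊙ g = ∑_η ζ^η ∑_{0 ≤ ν ≤ η} f_ν g_{η-ν}`; the inner sum is the multiplication of formal power
series with coefficients in `ℍ` and central variables. -/
def ckMul (f g : ℍ[ℝ] → ℍ[ℝ]) : ℍ[ℝ] → ℍ[ℝ] := fueterSum (coeffs f * coeffs g)

/-- An `ℍ`-valued polynomial in the real variables `x₀, x₁, x₂, x₃`. -/
def IsPolynomial (f : ℍ[ℝ] → ℍ[ℝ]) : Prop :=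
  ∃ p : Fin 4 → MvPolynomial (Fin 4) ℝ, ∀ x : ℍ[ℝ],
    f x = ⟨MvPolynomial.eval ![x.re, x.imI, x.imJ, x.imK] (p 0),
           MvPolynomial.eval ![x.re, x.imI, x.imJ, x.imK] (p 1),
           MvPolynomial.eval ![x.re, x.imI, x.imJ, x.imK] (p 2),
           MvPolynomial.eval ![x.re, x.imI, x.imJ, x.imK] (p 3)⟩

/-- `S` is a subring of the ring `HypO` (with the C-K-product) which contains the hyperholomorphic
polynomials and is closed under C-K-inversion. The field `congr` says that `S` is compatible with
the equality of `HypO`. The unit of the ring lies in `S`, being a polynomial. -/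
structure IsInversionClosedSubring (S : Set (ℍ[ℝ] → ℍ[ℝ])) : Prop where
  subset : S ⊆ HypO
  congr : ∀ f ∈ S, ∀ g, f =ᶠ[𝓝 0] g → g ∈ S
  add : ∀ f ∈ S, ∀ g ∈ S, f + g ∈ S
  neg : ∀ f ∈ S, -f ∈ S
  mul : ∀ f ∈ S, ∀ g ∈ S, ckMul f g ∈ S
  poly : ∀ f ∈ HypO, IsPolynomial f → f ∈ S
  inv : ∀ r ∈ S, r 0 ≠ 0 → ∃ s ∈ S,
    ckMul r s =ᶠ[𝓝 0] (fun _ => 1) ∧ ckMul s r =ᶠ[𝓝 0] (fun _ => 1)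

/-- The minimal subring of `HypO` which contains the hyperholomorphic polynomials and is closed
under C-K-inversion. -/
def RatQ : Set (ℍ[ℝ] → ℍ[ℝ]) := {f | ∀ S, IsInversionClosedSubring S → f ∈ S}

/-- Matrix-valued functions, as matrices of functions. -/
abbrev MatFun (m n : ℕ) := Matrix (Fin m) (Fin n) (ℍ[ℝ] → ℍ[ℝ])

variable {m n p : ℕ}

/-- All entries are left-hyperholomorphic in a neighbourhood of the origin. -/
def IsHyp (F : MatFun m n) : Prop := ∀ i j, F i j ∈ HypO

/-- Equality in a neighbourhood of the origin. -/
def GermEq (F G : MatFun m n) : Prop := ∀ i j, F i j =ᶠ[𝓝 0] G i j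

/-- The C-K-product of matrix-valued functions. -/
def ckMatMul (F : MatFun m n) (G : MatFun n p) : MatFun m p :=
  Matrix.of fun i k => ∑ j, ckMul (F i j) (G j k)

/-- A constant matrix as a function. -/
def constMat (D : Matrix (Fin m) (Fin n) ℍ[ℝ]) : MatFun m n :=
  Matrix.of fun i j _ => D i j

/-- The function `ζ₁ A₁ + ζ₂ A₂ + ζ₃ A₃`, abbreviated `ζA`. -/
def zetaMat (A : Fin 3 → Matrix (Fin m) (Fin n) ℍ[ℝ]) : MatFun m n :=
  Matrix.of fun i j x => ∑ k, zeta k x * A k i j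

/-- `G` is the C-K-inverse of `F` in the ring of square matrices over `HypO`. -/
def IsCKInverse (F G : MatFun n n) : Prop :=
  IsHyp F ∧ IsHyp G ∧ GermEq (ckMatMul F G) (constMat 1) ∧ GermEq (ckMatMul G F) (constMat 1)

/-- `R = D + C ⊙ (I - ζA)^{-⊙} ⊙ ζB` near the origin, for constant matrices `A₁, A₂, A₃` of size
`ℓ × ℓ`, `B₁, B₂, B₃` of size `ℓ × n`, `C` of size `m × ℓ` and `D` of size `m × n`. -/
def HasRealization (R : MatFun m n) : Prop :=
  ∃ (ℓ : ℕ) (A : Fin 3 → Matrix (Fin ℓ) (Fin ℓ) ℍ[ℝ]) (B : Fin 3 → Matrix (Fin ℓ) (Fin n) ℍ[ℝ])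
    (C : Matrix (Fin m) (Fin ℓ) ℍ[ℝ]) (D : Matrix (Fin m) (Fin n) ℍ[ℝ]) (W : MatFun ℓ ℓ),
    IsCKInverse (constMat 1 - zetaMat A) W ∧
      GermEq R (constMat D + ckMatMul (ckMatMul (constMat C) W) (zetaMat B))

end Hyperholomorphic

end

/-!
The proof moves the statement from germs of functions to formal power series in three central
variables with coefficients in `ℍ`, where it becomes linear algebra over a noncommutative ring.

*From germs to power series.* The map `f ↦ coeffs f` identifies the germs of left-hyperholomorphic
functions with the power series whose coefficients grow at most geometrically, and it takes the C-K
product to the product of power series (`eventuallyEq_iff_coeffs_eq`, `coeffs_ckMul`). Three facts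
are behind this.

* A hyperholomorphic function is real-analytic (`analyticAt_of_mem_HypO`). As only differentiability
  is assumed, the Gauss-Green identity is taken from the divergence theorem that needs no continuity
  of the derivative. Applied to the product of a cutoff with the regularized kernel
  `z̄ / (|z|² + a)²`, it gives for `a → 0` an integral representation by the Cauchy-Fueter kernel over
  a compact set away from the origin, and such an integral is analytic.
* The Fueter polynomials are the normalized coefficients of the powers of the plane wave
  `∑ₖ ζₖ(x) Xₖ` (`fueter_eq_coeff`). The values of the plane wave at different points commute, so
  that the derivative of `ζ^ν` is `∑ₖ νₖ (dζₖ) ζ^(ν - δₖ)`, `δₖ` the unit multi-index. Therefore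
  a convergent Fueter series can be differentiated termwise, is hyperholomorphic, and has the
  prescribed coefficients.
* A hyperholomorphic function with vanishing coefficients vanishes near the origin, because the
  Cauchy-Fueter equation expresses derivatives in `x₀` by those in `x₁, x₂, x₃`.

*Realizable functions are rational.* The entries of `ζA` vanish at the origin. Over a ring in which
the elements with nonzero constant term are invertible, such a matrix lies in the Jacobson radical
of the matrix ring, so that `1 - ζA` is invertible (`exists_matrix_inverse`). Over the convergent
power series this yields the C-K inverse. Over any inversion-closed subring it yields, by the
uniqueness of inverses, that the entries of the C-K inverse belong to that subring.

*Rational functions are realizable.* Call a power series rational if it lies in a finitely generated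
left `ℍ`-space `V` of power series with `V ⊆ ℍ + ∑ₖ Xₖ V`. The spaces `V + W`, `V s + W` and
`V s + ℍ s` show that the rational series are closed under sums, products and inverses, and
polynomials are rational since they have finitely many nonzero coefficients. Hence the functions
with rational power series form an inversion-closed subring, which contains the smallest one. For
finitely many rational series with a common generating vector `u` of such a space, the inclusion
reads `u = v + (∑ₖ Xₖ Aₖ) u`, so that `u - v = (1 - ∑ₖ Xₖ Aₖ)⁻¹ (∑ₖ Xₖ Aₖ) v`; this is the
realization (`hasRealization_of_isRational`).
-/

/-! ### The Gauss-Green identity and the regularized Cauchy-Fueter kernel -/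

noncomputable section

namespace Hyperholomorphic

open MeasureTheory Set Filter

/-- The real basis `1, e₁, e₂, e₃` of `ℍ`. -/
def basisH : Fin 4 → ℍ[ℝ] := ![1, e 0, e 1, e 2]

/-- The identification `y ↦ y₀ + y₁ e₁ + y₂ e₂ + y₃ e₃` of `ℝ⁴` with `ℍ`. The source carries the
sup norm and the volume of a finite product, as needed for the divergence theorem on boxes. -/
def ofCoords : (Fin 4 → ℝ) ≃L[ℝ] ℍ[ℝ] :=
  (EuclideanSpace.equiv (Fin 4) ℝ).symm.trans
    Quaternion.linearIsometryEquivTuple.symm.toContinuousLinearEquiv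

@[simp] theorem ofCoords_re (y : Fin 4 → ℝ) : (ofCoords y).re = y 0 := rfl
@[simp] theorem ofCoords_imI (y : Fin 4 → ℝ) : (ofCoords y).imI = y 1 := rfl
@[simp] theorem ofCoords_imJ (y : Fin 4 → ℝ) : (ofCoords y).imJ = y 2 := rfl
@[simp] theorem ofCoords_imK (y : Fin 4 → ℝ) : (ofCoords y).imK = y 3 := rfl

@[simp] theorem e_re (k : Fin 3) : (e k).re = 0 := by fin_cases k <;> rfl
@[simp] theorem e_imI (k : Fin 3) : (e k).imI = if k = 0 then 1 else 0 := by fin_cases k <;> rfl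
@[simp] theorem e_imJ (k : Fin 3) : (e k).imJ = if k = 1 then 1 else 0 := by fin_cases k <;> rfl
@[simp] theorem e_imK (k : Fin 3) : (e k).imK = if k = 2 then 1 else 0 := by fin_cases k <;> rfl

theorem ofCoords_eq_sum (y : Fin 4 → ℝ) : ofCoords y = ∑ i, y i • basisH i := by
  ext <;> simp [Fin.sum_univ_four, basisH]

theorem ofCoords_single (i : Fin 4) : ofCoords (Pi.single i 1) = basisH i := by
  rw [ofCoords_eq_sum]
  simp [Pi.single_apply]

theorem star_basisH_mul_self (i : Fin 4) : star (basisH i) * basisH i = 1 := by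
  fin_cases i <;> ext <;> simp [basisH]

theorem normSq_ofCoords (y : Fin 4 → ℝ) : Quaternion.normSq (ofCoords y) = ∑ i, y i ^ 2 := by
  rw [Quaternion.normSq_def', Fin.sum_univ_four]
  rfl

theorem cauchyFueter_eq_sum (f : ℍ[ℝ] → ℍ[ℝ]) (x : ℍ[ℝ]) :
    cauchyFueter f x = ∑ i, basisH i * fderiv ℝ f x (basisH i) := by
  simp [cauchyFueter, pderiv, Fin.sum_univ_succ, basisH]

/-- The Gauss-Green identity for a left-hyperholomorphic `f` and a `C¹` function `G` that vanishes
on the faces of the box and outside. No continuity of the derivative of `f` is needed: the terms in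
which it occurs add up to zero. -/
theorem integral_box_rightFueter_mul_eq_zero {f : ℍ[ℝ] → ℍ[ℝ]} {ρ : ℝ} (hρ : 0 < ρ)
    (hf : ∀ y ∈ Icc (fun _ => -ρ : Fin 4 → ℝ) (fun _ => ρ),
      DifferentiableAt ℝ f (ofCoords y) ∧ cauchyFueter f (ofCoords y) = 0)
    {G : (Fin 4 → ℝ) → ℍ[ℝ]} {G' : (Fin 4 → ℝ) → (Fin 4 → ℝ) →L[ℝ] ℍ[ℝ]}
    (hG : ∀ y, HasFDerivAt G (G' y) y) (hG' : ∀ v, Continuous fun y => G' y v)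
    (hz : ∀ y : Fin 4 → ℝ, (∃ i, ρ ≤ |y i|) → G y = 0) :
    ∫ y in Icc (fun _ => -ρ : Fin 4 → ℝ) (fun _ => ρ),
      ∑ i, G' y (Pi.single i 1) * basisH i * f (ofCoords y) = 0 := by
  set a : Fin 4 → ℝ := fun _ => -ρ
  set b : Fin 4 → ℝ := fun _ => ρ
  have hab : a ≤ b := fun i => by simp [a, b]; linarith
  have hfc : ContinuousOn (fun y => f (ofCoords y)) (Icc a b) := fun y hy =>
    ((hf y hy).1.continuousAt.comp ofCoords.continuous.continuousAt).continuousWithinAt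
  have hGc : Continuous G := continuous_iff_continuousAt.2 fun y => (hG y).continuousAt
  let F : Fin 4 → (Fin 4 → ℝ) → ℍ[ℝ] := fun i y => G y * basisH i * f (ofCoords y)
  let F' : Fin 4 → (Fin 4 → ℝ) → (Fin 4 → ℝ) →L[ℝ] ℍ[ℝ] := fun i y =>
    (G y * basisH i) • ((fderiv ℝ f (ofCoords y)).comp (ofCoords : (Fin 4 → ℝ) →L[ℝ] ℍ[ℝ])) +
      (MulOpposite.op (f (ofCoords y))) • ((MulOpposite.op (basisH i)) • G' y)
  have hsum : ∀ y ∈ Icc a b, ∑ i, F' i y (Pi.single i 1) =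
      ∑ i, G' y (Pi.single i 1) * basisH i * f (ofCoords y) := by
    intro y hy
    have h := (hf y hy).2
    rw [cauchyFueter_eq_sum] at h
    have : ∀ i, F' i y (Pi.single i 1) = G y * (basisH i * fderiv ℝ f (ofCoords y) (basisH i)) +
        G' y (Pi.single i 1) * basisH i * f (ofCoords y) := by
      intro i
      simp [F', ofCoords_single, mul_assoc]
    simp only [this, Finset.sum_add_distrib, ← Finset.mul_sum, h, mul_zero, zero_add]
  have key := integral_divergence_of_hasFDerivAt_off_countable' a b hab F F' ∅ countable_empty
    (fun i => (hGc.continuousOn.mul continuousOn_const).mul hfc)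
    (fun y hy i => by
      have hy' : y ∈ Icc a b := ⟨fun i => (hy.1 i trivial).1.le, fun i => (hy.1 i trivial).2.le⟩
      have h1 : HasFDerivAt (fun y => G y * basisH i) ((MulOpposite.op (basisH i)) • G' y) y :=
        (hG y).mul_const' (basisH i)
      have h2 := (hf y hy').1.hasFDerivAt.comp y ofCoords.hasFDerivAt
      exact h1.mul' h2)
    (by
      refine IntegrableOn.congr_fun ?_ (fun y hy => (hsum y hy).symm) measurableSet_Icc
      refine ContinuousOn.integrableOn_compact isCompact_Icc ?_
      refine continuousOn_finsetSum _ fun i _ => ?_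
      exact ((hG' _).continuousOn.mul continuousOn_const).mul hfc)
  rw [setIntegral_congr_fun measurableSet_Icc hsum] at key
  rw [key]
  refine Finset.sum_eq_zero fun i _ => ?_
  have hF : ∀ t x, |t| = ρ → F i (i.insertNth t x) = 0 := by
    intro t x ht
    simp only [F]
    rw [hz _ ⟨i, by simp [ht]⟩]
    simp
  rw [setIntegral_congr_fun measurableSet_Icc (fun x _ => hF (b i) x (by simp [b, hρ.le])),
    setIntegral_congr_fun measurableSet_Icc (fun x _ => hF (a i) x (by simp [a, hρ.le]))]
  simp

/-- The conjugate of `ofCoords`. -/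
def starOfCoords : (Fin 4 → ℝ) →L[ℝ] ℍ[ℝ] :=
  LinearMap.toContinuousLinearMap
    { toFun := fun z => star (ofCoords z)
      map_add' := fun x y => by simp
      map_smul' := fun c x => by simp [Quaternion.star_smul] }

theorem starOfCoords_apply (z : Fin 4 → ℝ) : starOfCoords z = star (ofCoords z) := rfl

/-- The Cauchy-Fueter kernel `z̄ / |z|⁴`, regularized as `z̄ / (|z|² + a)²`. -/
def regKernel (a : ℝ) (z : Fin 4 → ℝ) : ℍ[ℝ] :=
  ((∑ i, z i ^ 2 + a) ^ 2)⁻¹ • star (ofCoords z)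

/-- The derivative of the regularized kernel, `(|z|² + a)⁻² dz̄ - 4 (|z|² + a)⁻³ ⟨z, dz⟩ z̄`. -/
def regKernelDeriv (a : ℝ) (z : Fin 4 → ℝ) : (Fin 4 → ℝ) →L[ℝ] ℍ[ℝ] :=
  ((∑ i, z i ^ 2 + a) ^ 2)⁻¹ • starOfCoords +
    (-4 * ((∑ i, z i ^ 2 + a) ^ 3)⁻¹) •
      (∑ i, z i • (ContinuousLinearMap.proj i : (Fin 4 → ℝ) →L[ℝ] ℝ)).smulRight (star (ofCoords z))

theorem sum_sq_add_pos {a : ℝ} (ha : 0 < a) (z : Fin 4 → ℝ) : 0 < ∑ i, z i ^ 2 + a := by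
  positivity

theorem hasFDerivAt_regKernel {a : ℝ} (ha : 0 < a) (z : Fin 4 → ℝ) :
    HasFDerivAt (regKernel a) (regKernelDeriv a z) z := by
  have hs := sum_sq_add_pos ha z
  have h1 : HasFDerivAt (fun z : Fin 4 → ℝ => ∑ i, z i ^ 2 + a)
      ((2 : ℝ) • ∑ i, z i • (ContinuousLinearMap.proj i : (Fin 4 → ℝ) →L[ℝ] ℝ)) z := by
    have : HasFDerivAt (fun z : Fin 4 → ℝ => ∑ i, z i ^ 2)
      (∑ i, (2 : ℝ) • z i • (ContinuousLinearMap.proj i : (Fin 4 → ℝ) →L[ℝ] ℝ)) z := by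
      refine HasFDerivAt.fun_sum fun i _ => ?_
      have := (hasFDerivAt_apply (𝕜 := ℝ) (F' := fun _ : Fin 4 => ℝ) i z).pow 2
      convert! this using 1
      ext v; simp; ring
    rw [Finset.smul_sum]
    exact this.add_const a
  have h2 : HasFDerivAt (fun z : Fin 4 → ℝ => ((∑ i, z i ^ 2 + a) ^ 2)⁻¹)
      ((-4 * ((∑ i, z i ^ 2 + a) ^ 3)⁻¹) •
        ∑ i, z i • (ContinuousLinearMap.proj i : (Fin 4 → ℝ) →L[ℝ] ℝ)) z := by
    have hd : HasDerivAt (fun t : ℝ => (t ^ 2)⁻¹) (-2 * ((∑ i, z i ^ 2 + a) ^ 3)⁻¹)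
        (∑ i, z i ^ 2 + a) := by
      have := (hasDerivAt_pow 2 (∑ i, z i ^ 2 + a)).inv (by positivity)
      refine this.congr_deriv ?_
      have := hs.ne'
      field_simp
      norm_num [mul_comm]
    have := hd.comp_hasFDerivAt z h1
    convert! this using 1
    rw [smul_smul]; congr 1; ring
  have h3 : HasFDerivAt (fun z : Fin 4 → ℝ => starOfCoords z) starOfCoords z :=
    starOfCoords.hasFDerivAt
  have := h2.smul h3
  convert! this using 1
  ext1 v
  simp [regKernelDeriv, starOfCoords_apply, mul_assoc, smul_smul]

theorem continuous_regKernelDeriv_apply {a : ℝ} (ha : 0 < a) (v : Fin 4 → ℝ) :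
    Continuous fun z => regKernelDeriv a z v := by
  have hs := sum_sq_add_pos ha
  have h1 : Continuous fun z : Fin 4 → ℝ => star (ofCoords z) := starOfCoords.continuous
  have h : ∀ k : ℕ, Continuous fun z : Fin 4 → ℝ => ((∑ i, z i ^ 2 + a) ^ k)⁻¹ := fun k =>
    .inv₀ (by fun_prop) fun z => (pow_pos (hs z) _).ne'
  simp only [regKernelDeriv, add_apply, smul_apply,
    ContinuousLinearMap.smulRight_apply, sum_apply]
  refine .add (.smul (h 2) continuous_const) (.smul (.mul continuous_const (h 3)) ?_)
  refine Continuous.smul (f := fun z : Fin 4 → ℝ => ∑ i, z i * v i) ?_ h1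
  fun_prop

/-- Applied from the right, the Cauchy-Fueter operator turns the regularized kernel into an
approximate identity. -/
theorem sum_regKernelDeriv_mul_basisH {a : ℝ} (ha : 0 < a) (z : Fin 4 → ℝ) :
    ∑ i, regKernelDeriv a z (Pi.single i 1) * basisH i =
      ((4 * a * ((∑ i, z i ^ 2 + a) ^ 3)⁻¹ : ℝ) : ℍ[ℝ]) := by
  have hs := (sum_sq_add_pos ha z).ne'
  set s := ∑ i, z i ^ 2 + a with hs_def
  have h1 : ∀ i, regKernelDeriv a z (Pi.single i 1) * basisH i =
      ((s ^ 2)⁻¹ : ℝ) • (1 : ℍ[ℝ]) +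
        (-4 * (s ^ 3)⁻¹ : ℝ) • (star (ofCoords z) * (z i • basisH i)) := by
    intro i
    simp only [regKernelDeriv, ← hs_def]
    simp [ofCoords_single, add_mul, star_basisH_mul_self, Pi.single_apply, starOfCoords_apply]
  have h2 : star (ofCoords z) * ofCoords z = ((s - a : ℝ) : ℍ[ℝ]) := by
    rw [Quaternion.star_mul_self, normSq_ofCoords, hs_def]; simp
  simp only [h1, Finset.sum_add_distrib, ← Finset.smul_sum, ← Finset.mul_sum, ← ofCoords_eq_sum, h2]
  have : ∀ r : ℝ, (r : ℍ[ℝ]) = r • (1 : ℍ[ℝ]) := fun r => by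
    ext <;> simp
  rw [this (s - a), this (4 * _ * _), smul_smul]
  simp only [Finset.sum_const, Finset.card_univ, Fintype.card_fin]
  rw [← Nat.cast_smul_eq_nsmul ℝ 4, smul_smul, ← add_smul]
  congr 1
  field_simp
  push_cast
  ring

end Hyperholomorphic

end

/-! ### A Cauchy-type integral formula -/

noncomputable section

namespace Hyperholomorphic

open MeasureTheory Set Filter

theorem norm_sq_le_sum_sq (z : Fin 4 → ℝ) : ‖z‖ ^ 2 ≤ ∑ i, z i ^ 2 := by
  have h : ‖z‖ ≤ √(∑ i, z i ^ 2) := (pi_norm_le_iff_of_nonneg (Real.sqrt_nonneg _)).2 fun i => by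
    rw [Real.norm_eq_abs, ← Real.sqrt_sq_eq_abs]
    exact Real.sqrt_le_sqrt (Finset.single_le_sum (f := fun i => z i ^ 2)
      (fun j _ => sq_nonneg (z j)) (Finset.mem_univ i))
  calc ‖z‖ ^ 2 ≤ √(∑ i, z i ^ 2) ^ 2 := by gcongr
    _ = _ := Real.sq_sqrt (by positivity)

/-- The mass of the approximate identity `c⁻² (|z|² + c⁻²)⁻³`, `c → ∞`; it does not depend on `c`. -/
def peakMass : ℝ := ∫ z : Fin 4 → ℝ, ((∑ i, z i ^ 2 + 1) ^ 3)⁻¹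

theorem continuous_inv_sum_sq_add_pow {a : ℝ} (ha : 0 < a) (k : ℕ) :
    Continuous fun z : Fin 4 → ℝ => ((∑ i, z i ^ 2 + a) ^ k)⁻¹ :=
  .inv₀ (by fun_prop) fun z => (pow_pos (sum_sq_add_pos ha z) _).ne'

theorem integrable_peak : Integrable fun z : Fin 4 → ℝ => ((∑ i, z i ^ 2 + 1) ^ 3)⁻¹ := by
  have h := integrable_rpow_neg_one_add_norm_sq (E := Fin 4 → ℝ) (μ := volume) (r := 6)
    (by simp; norm_num)
  refine h.mono' (continuous_inv_sum_sq_add_pow one_pos 3).aestronglyMeasurable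
    (.of_forall fun z => ?_)
  have h1 := norm_sq_le_sum_sq z
  rw [show (-6 / 2 : ℝ) = -((3 : ℕ) : ℝ) by norm_num, Real.rpow_neg (by positivity),
    Real.rpow_natCast, Real.norm_of_nonneg (by positivity)]
  rw [add_comm (1 : ℝ)]
  gcongr

theorem peakMass_pos : 0 < peakMass := by
  refine (integral_pos_iff_support_of_nonneg (fun z => by positivity) integrable_peak).2 ?_
  have : Function.support (fun z : Fin 4 → ℝ => ((∑ i, z i ^ 2 + 1) ^ 3)⁻¹) = univ :=
    eq_univ_of_forall fun z => by
      have := sum_sq_add_pos one_pos z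
      simp only [Function.mem_support]
      positivity
  rw [this]
  simp

/-- The functions `4 a (|z|² + a)⁻³`, to which the Cauchy-Fueter operator takes the regularized kernel,
concentrate at the origin for `a = c⁻²`, `c → ∞`. -/
theorem tendsto_peak {g : (Fin 4 → ℝ) → ℍ[ℝ]} (hg : Integrable g) {y₀ : Fin 4 → ℝ}
    (hc : ContinuousAt g y₀) :
    Tendsto (fun c : ℝ => ∫ y, (c⁻¹ ^ 2 * ((∑ i, (y - y₀) i ^ 2 + c⁻¹ ^ 2) ^ 3)⁻¹) • g y) atTop
      (𝓝 (peakMass • g y₀)) := by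
  have h := tendsto_integral_comp_smul_smul_of_integrable' (μ := (volume : Measure (Fin 4 → ℝ)))
    (show ∀ z : Fin 4 → ℝ, 0 ≤ peakMass⁻¹ * ((∑ i, z i ^ 2 + 1) ^ 3)⁻¹ from
      fun z => mul_nonneg (inv_nonneg.2 peakMass_pos.le) (by positivity))
    (by rw [integral_const_mul]; exact inv_mul_cancel₀ peakMass_pos.ne') ?_ hg hc
  · have h2 := h.const_smul peakMass
    refine h2.congr' ?_
    filter_upwards [eventually_gt_atTop 0] with c hcpos
    rw [← integral_smul]
    refine integral_congr_ae (.of_forall fun y => ?_)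
    simp only [smul_smul]
    congr 1
    have h3 := (sum_sq_add_pos (pow_pos (inv_pos.2 hcpos) 2) (y - y₀)).ne'
    have h4 : ∑ i, (c • (y₀ - y)) i ^ 2 + 1 = c ^ 2 * (∑ i, (y - y₀) i ^ 2 + c⁻¹ ^ 2) := by
      rw [mul_add, Finset.mul_sum]
      congr 1
      · refine Finset.sum_congr rfl fun i _ => ?_
        simp; ring
      · field_simp
    rw [h4]
    have := peakMass_pos.ne'
    simp only [Module.finrank_fin_fun]
    field_simp
  · have h0 : Tendsto (fun x : Fin 4 → ℝ => peakMass⁻¹ * ‖x‖⁻¹) (Bornology.cobounded _) (𝓝 0) := by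
      simpa using (tendsto_inv_atTop_zero.comp tendsto_norm_cobounded_atTop).const_mul peakMass⁻¹
    refine squeeze_zero' (.of_forall fun z => ?_) ?_ h0
    · have := peakMass_pos
      positivity
    · filter_upwards [tendsto_norm_cobounded_atTop.eventually_ge_atTop 1] with z hz
      have h1 := norm_sq_le_sum_sq z
      have := peakMass_pos
      rw [mul_left_comm]
      gcongr
      simp only [Module.finrank_fin_fun]
      rw [← div_eq_mul_inv, div_le_iff₀ (by positivity), inv_mul_eq_div, le_div_iff₀ (by positivity)]
      calc ‖z‖ ^ 4 * ‖z‖ = ‖z‖ ^ 5 := by ring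
        _ ≤ ‖z‖ ^ 6 := pow_le_pow_right₀ hz (by norm_num)
        _ = (‖z‖ ^ 2) ^ 3 := by ring
        _ ≤ _ := by gcongr; linarith

/-- A Cauchy-type integral formula: near the origin a left-hyperholomorphic function is the
integral, over a set away from the origin, of the Cauchy-Fueter kernel against a continuous
density. -/
theorem exists_cauchy_representation {f : ℍ[ℝ] → ℍ[ℝ]} {ρ : ℝ} (hρ : 0 < ρ)
    (hf : ∀ y ∈ Icc (fun _ => -ρ : Fin 4 → ℝ) (fun _ => ρ),
      DifferentiableAt ℝ f (ofCoords y) ∧ cauchyFueter f (ofCoords y) = 0) :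
    ∃ (Y : Set (Fin 4 → ℝ)) (h : (Fin 4 → ℝ) → ℍ[ℝ]), IsCompact Y ∧ 0 ∉ Y ∧ ContinuousOn h Y ∧
      ∀ᶠ y₀ in 𝓝 (0 : Fin 4 → ℝ),
        f (ofCoords y₀) = ∫ y in Y, regKernel 0 (y - y₀) * h y := by
  set B := Icc (fun _ => -ρ : Fin 4 → ℝ) (fun _ => ρ) with hB
  have hfc : ContinuousOn (fun y => f (ofCoords y)) B := fun y hy =>
    ((hf y hy).1.continuousAt.comp ofCoords.continuous.continuousAt).continuousWithinAt
  -- The density is supported where the cutoff `η` is not locally constant, hence off the origin.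
  let η : ContDiffBump (0 : Fin 4 → ℝ) := ⟨ρ / 3, ρ / 2, by linarith, by linarith⟩
  have hηd : ∀ y, HasFDerivAt η (fderiv ℝ η y) y := fun y =>
    (η.contDiff (n := 1)).differentiable (by simp) y |>.hasFDerivAt
  have hη'c : Continuous (fderiv ℝ η) := (η.contDiff (n := 1)).continuous_fderiv (by simp)
  let h : (Fin 4 → ℝ) → ℍ[ℝ] := fun y =>
    ∑ i, fderiv ℝ η y (Pi.single i 1) • (basisH i * f (ofCoords y))
  have hhc : ContinuousOn h B := continuousOn_finsetSum _ fun i _ =>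
    (hη'c.clm_apply continuous_const).continuousOn.smul (continuousOn_const.mul hfc)
  have hh0 : ∀ y, ‖y‖ < ρ / 3 → h y = 0 := by
    intro y hy
    have : fderiv ℝ η y = 0 := by
      have h1 : (η : (Fin 4 → ℝ) → ℝ) =ᶠ[𝓝 y] fun _ => 1 :=
        η.eventuallyEq_one_of_mem_ball (by simpa using hy)
      rw [h1.fderiv_eq]; simp
    simp [h, this]
  have hBnorm : ∀ y, ‖y‖ ≤ ρ → y ∈ B := fun y hy => by
    have := (pi_norm_le_iff_of_nonneg hρ.le).1 hy
    exact ⟨fun i => (abs_le.1 (this i)).1, fun i => (abs_le.1 (this i)).2⟩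
  -- The Gauss-Green identity for the product of the cutoff with the regularized kernel.
  have green : ∀ a : ℝ, 0 < a → ∀ y₀ : Fin 4 → ℝ,
      (∫ y in B, regKernel a (y - y₀) * h y) +
        ∫ y in B, (4 * a * ((∑ i, (y - y₀) i ^ 2 + a) ^ 3)⁻¹) • (η y • f (ofCoords y)) = 0 := by
    intro a ha y₀
    have hK : ∀ y, HasFDerivAt (fun y => regKernel a (y - y₀)) (regKernelDeriv a (y - y₀)) y :=
      fun y => by
        have := (hasFDerivAt_regKernel ha (y - y₀)).comp y ((hasFDerivAt_id y).sub_const y₀)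
        rwa [ContinuousLinearMap.comp_id] at this
    have hKc : Continuous fun y => regKernel a (y - y₀) :=
      continuous_iff_continuousAt.2 fun y => (hK y).continuousAt
    have key := integral_box_rightFueter_mul_eq_zero hρ hf
      (G := fun y => η y • regKernel a (y - y₀))
      (G' := fun y => η y • regKernelDeriv a (y - y₀) +
        (fderiv ℝ η y).smulRight (regKernel a (y - y₀)))
      (fun y => (hηd y).smul (hK y))
      (fun v => by
        simp only [add_apply, smul_apply, ContinuousLinearMap.smulRight_apply]
        exact (η.continuous.smul ((continuous_regKernelDeriv_apply ha v).comp
          (continuous_id.sub continuous_const))).add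
          ((hη'c.clm_apply continuous_const).smul hKc))
      (fun y ⟨i, hi⟩ => by
        have : η y = 0 := η.zero_of_le_dist (by
          have := norm_le_pi_norm y i
          rw [Real.norm_eq_abs] at this
          simp only [dist_zero_right, η]
          linarith)
        simp [this])
    rw [← integral_add, ← key]
    · refine setIntegral_congr_fun measurableSet_Icc fun y _ => ?_
      have h1 := sum_regKernelDeriv_mul_basisH ha (y - y₀)
      simp only [add_apply, smul_apply, ContinuousLinearMap.smulRight_apply, add_mul,
        Finset.sum_add_distrib, ← Finset.sum_mul, smul_mul_assoc, ← Finset.smul_sum, h1, h]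
      rw [add_comm]
      congr 1
      · rw [Quaternion.coe_mul_eq_smul, smul_comm]
      · rw [Finset.mul_sum]
        refine Finset.sum_congr rfl fun i _ => ?_
        rw [mul_smul_comm, mul_assoc]
    · exact (hKc.continuousOn.mul hhc).integrableOn_compact isCompact_Icc
    · refine ContinuousOn.integrableOn_compact isCompact_Icc ?_
      exact (continuous_const.mul ((continuous_inv_sum_sq_add_pow ha 3).comp
        (continuous_id.sub continuous_const))).continuousOn.smul (η.continuous.continuousOn.smul hfc)
  let Y : Set (Fin 4 → ℝ) := B ∩ {y | ρ / 3 ≤ ‖y‖}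
  have hYB : Y ⊆ B := inter_subset_left
  have hYc : IsCompact Y := isCompact_Icc.inter_right (isClosed_le continuous_const continuous_norm)
  refine ⟨Y, fun y => -(4 * peakMass)⁻¹ • h y, hYc, fun h => ?_,
    (continuousOn_const (c := -(4 * peakMass)⁻¹)).smul (hhc.mono hYB), ?_⟩
  · have := h.2
    simp at this
    linarith
  filter_upwards [Metric.ball_mem_nhds (0 : Fin 4 → ℝ) (show 0 < ρ / 6 by linarith)] with y₀ hy₀
  rw [mem_ball_zero_iff] at hy₀
  have hδ : ∀ y, ρ / 3 ≤ ‖y‖ → (ρ / 6) ^ 2 ≤ ∑ i, (y - y₀) i ^ 2 := fun y hy => by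
    refine le_trans ?_ (norm_sq_le_sum_sq _)
    have := norm_sub_norm_le y y₀
    gcongr
    linarith
  have lim1 : Tendsto (fun c : ℝ => ∫ y in B, regKernel (c⁻¹ ^ 2) (y - y₀) * h y) atTop
      (𝓝 (∫ y in B, regKernel 0 (y - y₀) * h y)) := by
    have hKc : Continuous fun y : Fin 4 → ℝ => star (ofCoords (y - y₀)) :=
      starOfCoords.continuous.comp (continuous_id.sub continuous_const)
    refine tendsto_integral_filter_of_dominated_convergence
      (fun y => ‖(((ρ / 6) ^ 2) ^ 2)⁻¹ • (star (ofCoords (y - y₀)) * h y)‖) ?_ ?_ ?_ ?_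
    · filter_upwards [eventually_gt_atTop 0] with c hc
      refine (ContinuousOn.integrableOn_compact isCompact_Icc ?_).aestronglyMeasurable
      refine ContinuousOn.mul (Continuous.continuousOn ?_) hhc
      exact ((continuous_inv_sum_sq_add_pow (pow_pos (inv_pos.2 hc) 2) 2).comp
        (continuous_id.sub continuous_const)).smul hKc
    · filter_upwards [eventually_gt_atTop 0] with c hc
      refine .of_forall fun y => ?_
      rcases lt_or_ge ‖y‖ (ρ / 3) with hy | hy
      · simp [hh0 y hy]
      · rw [regKernel, smul_mul_assoc, norm_smul, norm_smul]
        have := hδ y hy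
        have h2 : (((∑ i, (y - y₀) i ^ 2 + c⁻¹ ^ 2) ^ 2)⁻¹ : ℝ) ≤ (((ρ / 6) ^ 2) ^ 2)⁻¹ := by
          gcongr
          have := sq_nonneg c⁻¹
          linarith
        rw [Real.norm_of_nonneg (by positivity), Real.norm_of_nonneg (by positivity)]
        gcongr
    · refine (ContinuousOn.integrableOn_compact isCompact_Icc ?_).norm
      exact (continuousOn_const (c := ((((ρ / 6) ^ 2) ^ 2)⁻¹ : ℝ))).smul (hKc.continuousOn.mul hhc)
    · refine .of_forall fun y => ?_
      rcases lt_or_ge ‖y‖ (ρ / 3) with hy | hy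
      · simp [hh0 y hy]
      · refine Tendsto.mul_const _ (Tendsto.smul_const ?_ _)
        have h0 : Tendsto (fun c : ℝ => c⁻¹ ^ 2) atTop (𝓝 0) := by
          simpa using (tendsto_inv_atTop_zero (𝕜 := ℝ)).pow 2
        refine Tendsto.inv₀ ((h0.const_add _).pow 2) ?_
        have := hδ y hy
        have : 0 < ∑ i, (y - y₀) i ^ 2 := lt_of_lt_of_le (by positivity) this
        rw [add_zero]
        positivity
  have hy₀B : ‖y₀‖ < ρ := by linarith
  have lim2 := tendsto_peak (g := B.indicator fun y => η y • f (ofCoords y)) (y₀ := y₀)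
    ((integrable_indicator_iff measurableSet_Icc).2
      ((η.continuous.continuousOn.smul hfc).integrableOn_compact isCompact_Icc)) (by
      have hB' : B ∈ 𝓝 y₀ := mem_of_superset
        (Metric.isOpen_ball.mem_nhds (mem_ball_zero_iff.2 hy₀B))
        fun y hy => hBnorm y (mem_ball_zero_iff.1 hy).le
      refine ((η.continuous.continuousOn.smul hfc).continuousAt hB').congr ?_
      filter_upwards [hB'] with y hy
      rw [indicator_of_mem hy]
      rfl)
  have hg0 : B.indicator (fun y => η y • f (ofCoords y)) y₀ = f (ofCoords y₀) := by
    rw [indicator_of_mem (hBnorm _ hy₀B.le), η.one_of_mem_closedBall, one_smul]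
    simp only [η, mem_closedBall_zero_iff]
    linarith
  have : (∫ y in B, regKernel 0 (y - y₀) * h y) + (4 : ℝ) • peakMass • f (ofCoords y₀) = 0 := by
    rw [← hg0]
    refine tendsto_nhds_unique (lim1.add (lim2.const_smul (4 : ℝ))) ?_
    refine tendsto_const_nhds.congr' ?_
    filter_upwards [eventually_gt_atTop 0] with c hc
    rw [← green (c⁻¹ ^ 2) (by positivity) y₀, ← integral_smul]
    congr 1
    rw [← integral_indicator (s := B) measurableSet_Icc]
    refine integral_congr_ae (.of_forall fun y => ?_)
    by_cases hy : y ∈ B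
    · simp only [indicator_of_mem hy, smul_smul, mul_assoc]
    · simp [indicator_of_notMem hy]
  have hYint : ∫ y in Y, regKernel 0 (y - y₀) * -(4 * peakMass)⁻¹ • h y =
      -(4 * peakMass)⁻¹ • ∫ y in B, regKernel 0 (y - y₀) * h y := by
    simp only [mul_smul_comm]
    rw [integral_smul]
    congr 1
    symm
    refine setIntegral_eq_of_subset_of_forall_sdiff_eq_zero measurableSet_Icc hYB fun y hy => ?_
    rw [hh0 y, mul_zero]
    by_contra hlt
    exact hy.2 ⟨hy.1, not_lt.1 hlt⟩
  rw [hYint, eq_neg_of_add_eq_zero_left this, smul_smul, smul_neg, neg_smul, neg_neg, smul_smul,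
    inv_mul_cancel₀ (by have := peakMass_pos; positivity), one_smul]

end Hyperholomorphic

end

/-! ### Real-analyticity of hyperholomorphic functions -/

noncomputable section

namespace Hyperholomorphic

open MeasureTheory Set Filter

/-- The Cauchy-Fueter kernel as a product of inverses of real-linear functions of `z`. -/
theorem regKernel_zero_eq (z : Fin 4 → ℝ) :
    regKernel 0 z = (ofCoords z)⁻¹ ^ 2 * (star (ofCoords z))⁻¹ := by
  set q := ofCoords z
  have hs : Quaternion.normSq q = ∑ i, z i ^ 2 := normSq_ofCoords z
  have hi : q⁻¹ = (Quaternion.normSq q)⁻¹ • star q := rfl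
  have hi' : (star q)⁻¹ = (Quaternion.normSq (star q))⁻¹ • star (star q) := rfl
  rw [Quaternion.normSq_star, star_star] at hi'
  rw [regKernel, add_zero, ← hs, hi']
  rcases eq_or_ne q 0 with h | h
  · simp [h]
  · rw [mul_smul_comm, pow_two q⁻¹, mul_assoc, inv_mul_cancel₀ h, mul_one, hi, smul_smul]
    congr 1
    rw [pow_two, mul_inv]

/-- The Cauchy-Fueter kernel integrated over a compact set `Y` away from the origin is a
real-analytic function. Viewed in the Banach algebra `C(Y, ℍ)`, the kernel is a product of inverses
of affine functions of `x`, hence analytic in `x`, and integration over `Y` is a continuous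
functional. -/
theorem analyticAt_integral_kernel {Y : Set (Fin 4 → ℝ)} (hY : IsCompact Y) (h0 : 0 ∉ Y)
    {h : (Fin 4 → ℝ) → ℍ[ℝ]} (hh : ContinuousOn h Y) :
    AnalyticAt ℝ (fun x : ℍ[ℝ] => ∫ y in Y, regKernel 0 (y - ofCoords.symm x) * h y) 0 := by
  have : CompactSpace Y := isCompact_iff_compactSpace.1 hY
  let μ : Measure Y := Measure.comap Subtype.val volume
  have : IsFiniteMeasure μ := ⟨by
    rw [Measure.comap_apply _ Subtype.val_injective
      (fun s hs => hY.measurableSet.subtype_image hs) _ MeasurableSet.univ]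
    simpa using hY.measure_lt_top⟩
  have hhY : Continuous fun y : Y => h y := continuousOn_iff_continuous_domRestrict.1 hh
  have hint : ∀ g : C(Y, ℍ[ℝ]), Integrable (fun y : Y => g y * h y) μ := fun g =>
    (g.continuous.mul hhY).integrable_of_hasCompactSupport (HasCompactSupport.of_compactSpace _)
  have hint' : Integrable (fun y : Y => ‖h y‖) μ :=
    (hhY.norm).integrable_of_hasCompactSupport (HasCompactSupport.of_compactSpace _)
  let Λ : C(Y, ℍ[ℝ]) →L[ℝ] ℍ[ℝ] := LinearMap.mkContinuous
    { toFun := fun g => ∫ y, g y * h y ∂μ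
      map_add' := fun f g => by
        simp only [ContinuousMap.add_apply, add_mul]
        exact integral_add (hint f) (hint g)
      map_smul' := fun c g => by
        simp only [ContinuousMap.smul_apply, smul_mul_assoc, RingHom.id_apply]
        exact integral_smul c _ }
    (∫ y, ‖h y‖ ∂μ) (fun g => by
      simp only [LinearMap.coe_mk, AddHom.coe_mk]
      rw [mul_comm, ← integral_const_mul]
      refine norm_integral_le_of_norm_le (hint'.const_mul _) (.of_forall fun y => ?_)
      rw [norm_mul]
      gcongr
      exact g.norm_coe_le_norm y)
  let K : ℍ[ℝ] →L[ℝ] C(Y, ℍ[ℝ]) := LinearMap.toContinuousLinearMap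
    { toFun := fun x => ContinuousMap.const Y x
      map_add' := fun _ _ => rfl
      map_smul' := fun _ _ => rfl }
  let S : ℍ[ℝ] →L[ℝ] C(Y, ℍ[ℝ]) := LinearMap.toContinuousLinearMap
    { toFun := fun x => ContinuousMap.const Y (star x)
      map_add' := fun _ _ => by ext1; simp
      map_smul' := fun _ _ => by ext1; simp [Quaternion.star_smul] }
  let u : C(Y, ℍ[ℝ]) := ⟨fun y => ofCoords y, ofCoords.continuous.comp continuous_subtype_val⟩
  let v : C(Y, ℍ[ℝ]) := ⟨fun y => star (ofCoords y),
    starOfCoords.continuous.comp continuous_subtype_val⟩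
  have hne : ∀ y : Y, ofCoords y ≠ 0 := fun y hy => h0 <| by
    have : (y : Fin 4 → ℝ) = 0 := by simpa using hy
    rw [← this]; exact y.2
  have hu : IsUnit (u - K 0) := by
    rw [map_zero, sub_zero]
    exact ContinuousMap.isUnit_iff_forall_isUnit u |>.2 fun y => (hne y).isUnit
  have hv : IsUnit (v - S 0) := by
    rw [map_zero, sub_zero]
    exact ContinuousMap.isUnit_iff_forall_isUnit v |>.2 fun y => (star_ne_zero.2 (hne y)).isUnit
  have hua : AnalyticAt ℝ (fun x => u - K x) 0 := analyticAt_const.sub (K.analyticAt 0)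
  have hva : AnalyticAt ℝ (fun x => v - S x) 0 := analyticAt_const.sub (S.analyticAt 0)
  have hA : AnalyticAt ℝ (fun x => Ring.inverse (u - K x) ^ 2 * Ring.inverse (v - S x)) 0 := by
    refine AnalyticAt.mul (AnalyticAt.pow ?_ 2) ?_
    · exact AnalyticAt.comp (g := Ring.inverse) (analyticAt_inverse hu.unit) hua
    · exact AnalyticAt.comp (g := Ring.inverse) (analyticAt_inverse hv.unit) hva
  refine ((Λ.analyticAt _).comp hA).congr ?_
  have hinv : ∀ (w : C(Y, ℍ[ℝ])), IsUnit w → ∀ y, Ring.inverse w y = (w y)⁻¹ := fun w hw y => by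
    refine eq_inv_of_mul_eq_one_left ?_
    have := congrArg (fun g : C(Y, ℍ[ℝ]) => g y) (Ring.inverse_mul_cancel w hw)
    simpa using this
  filter_upwards [hua.continuousAt.eventually (Units.isOpen.mem_nhds hu),
    hva.continuousAt.eventually (Units.isOpen.mem_nhds hv)] with x hx hx'
  rw [← integral_subtype_comap hY.measurableSet
    (fun y => regKernel 0 (y - ofCoords.symm x) * h y)]
  refine integral_congr_ae (.of_forall fun y => ?_)
  simp only [ContinuousMap.mul_apply, ContinuousMap.pow_apply]
  rw [hinv _ hx, hinv _ hx', regKernel_zero_eq]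
  simp only [u, v, K, S, ContinuousMap.sub_apply, ContinuousMap.coe_mk, map_sub,
    ContinuousLinearEquiv.apply_symm_apply, star_sub, inv_pow]
  rfl

/-- A left-hyperholomorphic function is real-analytic; only differentiability is assumed of it, as in
Goursat's theorem. -/
theorem analyticAt_of_mem_HypO {f : ℍ[ℝ] → ℍ[ℝ]} (hf : f ∈ HypO) : AnalyticAt ℝ f 0 := by
  have h1 : ∀ᶠ y in 𝓝 (0 : Fin 4 → ℝ),
      DifferentiableAt ℝ f (ofCoords y) ∧ cauchyFueter f (ofCoords y) = 0 := by
    have : Tendsto ofCoords (𝓝 0) (𝓝 (0 : ℍ[ℝ])) := by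
      simpa using ofCoords.continuous.tendsto 0
    exact this.eventually hf
  obtain ⟨ρ, hρ, hball⟩ := Metric.nhds_basis_closedBall.mem_iff.1 h1
  obtain ⟨Y, h, hYc, h0, hh, hrep⟩ := exists_cauchy_representation hρ (fun y hy => hball (by
    rw [mem_closedBall_zero_iff, pi_norm_le_iff_of_nonneg hρ.le]
    exact fun i => abs_le.2 ⟨hy.1 i, hy.2 i⟩))
  refine (analyticAt_integral_kernel hYc h0 hh).congr ?_
  have : Tendsto ofCoords.symm (𝓝 (0 : ℍ[ℝ])) (𝓝 0) := by
    simpa using ofCoords.symm.continuous.tendsto 0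
  filter_upwards [this.eventually hrep] with x hx
  rw [← hx, ContinuousLinearEquiv.apply_symm_apply]

end Hyperholomorphic

end

/-! ### Fueter polynomials as coefficients of powers of a plane wave -/

noncomputable section

namespace Hyperholomorphic

open Finset
open Finsupp (single)

/-- `ζₖ` as a real-linear map. -/
def zetaL (k : Fin 3) : ℍ[ℝ] →L[ℝ] ℍ[ℝ] := LinearMap.toContinuousLinearMap
  { toFun := zeta k
    map_add' := fun x y => by
      ext <;> fin_cases k <;> simp [zeta] <;> ring
    map_smul' := fun c x => by
      ext <;> fin_cases k <;> simp [zeta] }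

@[simp] theorem zetaL_apply (k : Fin 3) (x : ℍ[ℝ]) : zetaL k x = zeta k x := rfl

theorem zeta_e (j k : Fin 3) : zeta j (e k) = if j = k then 1 else 0 := by
  ext <;> fin_cases j <;> fin_cases k <;> simp [zeta]

theorem zeta_one (k : Fin 3) : zeta k 1 = -e k := by
  ext <;> fin_cases k <;> simp [zeta]

theorem norm_e (k : Fin 3) : ‖e k‖ = 1 := by
  have : ‖e k‖ * ‖e k‖ = 1 := by
    rw [← Quaternion.normSq_eq_norm_mul_self, Quaternion.normSq_def']
    fin_cases k <;> simp
  nlinarith [norm_nonneg (e k)]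

theorem norm_zeta_le (k : Fin 3) (x : ℍ[ℝ]) : ‖zeta k x‖ ≤ 2 * ‖x‖ := by
  have hN : x.re ^ 2 + x.imI ^ 2 + x.imJ ^ 2 + x.imK ^ 2 = ‖x‖ ^ 2 := by
    rw [← Quaternion.normSq_def', Quaternion.normSq_eq_norm_mul_self, sq]
  have hre : |x.re| ≤ ‖x‖ := abs_le_of_sq_le_sq (by nlinarith) (norm_nonneg x)
  have him : |(![x.imI, x.imJ, x.imK] k : ℝ)| ≤ ‖x‖ :=
    abs_le_of_sq_le_sq (by fin_cases k <;> simp <;> nlinarith) (norm_nonneg x)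
  calc ‖zeta k x‖ ≤ ‖((![x.imI, x.imJ, x.imK] k : ℝ) : ℍ[ℝ])‖ + ‖(x.re : ℍ[ℝ]) * e k‖ :=
        norm_sub_le _ _
    _ ≤ ‖x‖ + ‖x‖ := by
        rw [norm_mul, norm_e, mul_one, Quaternion.norm_coe, Quaternion.norm_coe]
        exact add_le_add him hre
    _ = 2 * ‖x‖ := by ring

/-- The plane wave `∑ₖ ζₖ(x) Xₖ`, a power series in central variables `Xₖ`. The coefficients of its
powers are, up to normalization, the Fueter polynomials. -/
def zetaSeries (x : ℍ[ℝ]) : MvPowerSeries (Fin 3) ℍ[ℝ] :=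
  ∑ k, MvPowerSeries.monomial (single k 1) (zeta k x)

theorem coeff_zetaSeries_mul (x : ℍ[ℝ]) (ν : Fin 3 →₀ ℕ) (Q : MvPowerSeries (Fin 3) ℍ[ℝ]) :
    MvPowerSeries.coeff ν (zetaSeries x * Q) =
      ∑ k, if single k 1 ≤ ν then zeta k x * MvPowerSeries.coeff (ν - single k 1) Q else 0 := by
  rw [zetaSeries, sum_mul, map_sum]
  exact sum_congr rfl fun k _ => MvPowerSeries.coeff_monomial_mul ..

/-- Since `ζₖ(x) = xₖ - x₀ eₖ`, the values of the plane wave only involve central elements and the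
single element `∑ₖ eₖ Xₖ`. -/
theorem commute_zetaSeries (x y : ℍ[ℝ]) : Commute (zetaSeries x) (zetaSeries y) := by
  let A : ℍ[ℝ] → MvPowerSeries (Fin 3) ℍ[ℝ] := fun x =>
    ∑ k, MvPowerSeries.monomial (single k 1) ((![x.imI, x.imJ, x.imK] k : ℝ) : ℍ[ℝ])
  let C : ℝ → MvPowerSeries (Fin 3) ℍ[ℝ] := fun r => MvPowerSeries.monomial 0 (r : ℍ[ℝ])
  let E : MvPowerSeries (Fin 3) ℍ[ℝ] := ∑ k, MvPowerSeries.monomial (single k 1) (e k)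
  have hreal : ∀ (Q : MvPowerSeries (Fin 3) ℍ[ℝ]) (ν : Fin 3 →₀ ℕ) (r : ℝ),
      Commute Q (MvPowerSeries.monomial ν (r : ℍ[ℝ])) := fun Q ν r =>
    (MvPowerSeries.commute_monomial Q).2 fun m => (Quaternion.coe_commutes r _).symm
  have hA : ∀ x Q, Commute Q (A x) := fun x Q => Commute.sum_right _ _ _ fun k _ => hreal Q _ _
  have hz : ∀ x, zetaSeries x = A x - C x.re * E := fun x => by
    simp only [zetaSeries, A, C, E, zeta, map_sub, sum_sub_distrib, mul_sum,
      MvPowerSeries.monomial_mul_monomial, zero_add]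
  have hC : ∀ r Q, Commute Q (C r) := fun r Q => hreal Q _ _
  have hE : ∀ r s, Commute (C r * E) (C s * E) := fun r s =>
    ((hC s _).mul_right ((hC r E).symm.mul_left (Commute.refl E)))
  rw [hz x, hz y]
  exact ((hA y _).sub_right (((hA x _).symm.sub_left (hE _ _))))

/-- The derivative of a power of the plane wave is given by the commutative rule
`d(ζⁿ) = n (dζ) ζⁿ⁻¹`, because the values of the plane wave commute. -/
theorem hasFDerivAt_coeff_zetaSeries_pow (n : ℕ) : ∀ (ν : Fin 3 →₀ ℕ) (x : ℍ[ℝ]),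
    ∃ L : ℍ[ℝ] →L[ℝ] ℍ[ℝ],
      HasFDerivAt (fun x => MvPowerSeries.coeff ν (zetaSeries x ^ n)) L x ∧
      ∀ v, L v = n • MvPowerSeries.coeff ν (zetaSeries v * zetaSeries x ^ (n - 1)) := by
  induction n with
  | zero => exact fun ν x => ⟨0, by simpa using hasFDerivAt_const _ _, by simp⟩
  | succ n ih =>
    intro ν x
    choose L hL hLv using ih
    have hz : ∀ k, HasFDerivAt (zeta k) (zetaL k) x := fun k => (zetaL k).hasFDerivAt
    refine ⟨∑ k, if single k 1 ≤ ν then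
        (zeta k x) • L (ν - single k 1) x +
          MulOpposite.op (MvPowerSeries.coeff (ν - single k 1) (zetaSeries x ^ n)) • zetaL k
        else 0, ?_, fun v => ?_⟩
    · simp only [pow_succ', coeff_zetaSeries_mul]
      refine HasFDerivAt.fun_sum fun k _ => ?_
      split_ifs
      · exact (hz k).mul' (hL _ x)
      · exact hasFDerivAt_const _ _
    · have h1 : n • (zetaSeries v * zetaSeries x ^ n) =
          zetaSeries x * n • (zetaSeries v * zetaSeries x ^ (n - 1)) := by
        rcases n with _ | n
        · simp
        · rw [mul_smul_comm, Nat.add_sub_cancel, ← mul_assoc, (commute_zetaSeries x v).eq,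
            mul_assoc, ← pow_succ']
      rw [Nat.add_sub_cancel, succ_nsmul, ← map_nsmul, h1, coeff_zetaSeries_mul,
        coeff_zetaSeries_mul, ← sum_add_distrib, _root_.sum_apply]
      refine sum_congr rfl fun k _ => ?_
      split_ifs
      · rw [map_nsmul]
        simp [hLv]
      · simp

theorem zetaSeries_pow (x : ℍ[ℝ]) (n : ℕ) :
    zetaSeries x ^ n = ∑ w : Fin n → Fin 3, MvPowerSeries.monomial (∑ i, single (w i) 1)
      (List.ofFn fun i => zeta (w i) x).prod := by
  have h := (MultilinearMap.mkPiAlgebraFin ℕ n (MvPowerSeries (Fin 3) ℍ[ℝ])).map_sum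
    (g := fun _ k => MvPowerSeries.monomial (single k 1) (zeta k x))
  simp only [MultilinearMap.mkPiAlgebraFin_apply] at h
  rw [List.ofFn_const, List.prod_replicate] at h
  refine h.trans (sum_congr rfl fun w hw => ?_)
  clear h hw
  induction n with
  | zero => simp [MvPowerSeries.monomial_zero_one]
  | succ n ih =>
    rw [List.ofFn_succ, List.prod_cons, ih (fun i => w i.succ), List.ofFn_succ, List.prod_cons,
      Fin.sum_univ_succ, MvPowerSeries.monomial_mul_monomial]

theorem sum_single_apply {n : ℕ} (w : Fin n → Fin 3) (k : Fin 3) :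
    (∑ i, single (w i) 1 : Fin 3 →₀ ℕ) k = Fintype.card {i // w i = k} := by
  rw [Finsupp.finsetSum_apply, Fintype.card_subtype, card_filter]
  exact sum_congr rfl fun i _ => by rw [Finsupp.single_apply]

/-- The number of permutations that rearrange the word `w` into the word `w'`: it is the product
of the factorials of the multiplicities of the letters if `w'` has the same letters as `w`. -/
theorem card_perm_comp_eq {n : ℕ} (w w' : Fin n → Fin 3) :
    #{σ : Equiv.Perm (Fin n) | w ∘ σ = w'} =
      if (∑ i, single (w' i) 1 : Fin 3 →₀ ℕ) = ∑ i, single (w i) 1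
      then ∏ k, ((∑ i, single (w i) 1 : Fin 3 →₀ ℕ) k)! else 0 := by
  split_ifs with h
  · have hcard : ∀ k, Fintype.card {i // w' i = k} = Fintype.card {i // w i = k} := fun k => by
      rw [← sum_single_apply, ← sum_single_apply, h]
    let τ : Equiv.Perm (Fin n) := Equiv.ofFiberEquiv fun k => Fintype.equivOfCardEq (hcard k)
    have hτ : ∀ i, w (τ i) = w' i := fun i => Equiv.ofFiberEquiv_map _ i
    simp only [sum_single_apply]
    rw [← DomMulAct.stabilizer_card w, Fintype.card_subtype]
    refine card_bij' (fun σ _ => σ * τ⁻¹) (fun σ _ => σ * τ) ?_ ?_ ?_ ?_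
    · intro σ hσ
      simp only [mem_filter, mem_univ, true_and] at hσ ⊢
      ext i
      have := congrFun hσ (τ⁻¹ i)
      rw [← hτ] at this
      simpa using congrArg Fin.val this
    · intro σ hσ
      simp only [mem_filter, mem_univ, true_and] at hσ ⊢
      ext i
      have := congrFun hσ (τ i)
      rw [hτ] at this
      simpa using congrArg Fin.val this
    · simp
    · simp
  · rw [card_eq_zero, filter_eq_empty_iff]
    rintro σ - rfl
    exact h (by simpa using Equiv.sum_comp σ fun i => (single (w i) 1 : Fin 3 →₀ ℕ))

theorem symProd_eq_coeff {l : List ℍ[ℝ]} {x : ℍ[ℝ]} {ν : Fin 3 →₀ ℕ} (w : Fin l.length → Fin 3)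
    (hw : ∀ i, l.get i = zeta (w i) x) (hν : ∑ i, single (w i) 1 = ν) :
    symProd l = ((l.length ! : ℝ)⁻¹ * (∏ k, (ν k)! : ℕ)) •
      MvPowerSeries.coeff ν (zetaSeries x ^ l.length) := by
  rw [symProd, mul_smul, zetaSeries_pow, map_sum]
  congr 1
  let F : (Fin l.length → Fin 3) → ℍ[ℝ] := fun w => (List.ofFn fun i => zeta (w i) x).prod
  have h1 : ∑ σ : Equiv.Perm (Fin l.length), (List.ofFn fun i => l.get (σ i)).prod =
      ∑ σ : Equiv.Perm (Fin l.length), F (w ∘ σ) := by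
    simp only [hw]; rfl
  rw [h1, ← sum_fiberwise univ (fun σ : Equiv.Perm (Fin l.length) => w ∘ σ), smul_sum]
  refine sum_congr rfl fun w' _ => ?_
  rw [sum_congr rfl (g := fun _ => F w') fun σ hσ => by rw [(mem_filter.1 hσ).2], sum_const,
    card_perm_comp_eq, hν, MvPowerSeries.coeff_monomial]
  simp only [eq_comm (a := ν)]
  split_ifs
  · rw [← Nat.cast_smul_eq_nsmul ℝ]
  · simp

/-- The Fueter polynomials are the normalized coefficients of the powers of the plane wave. -/
theorem fueter_eq_coeff (ν : Fin 3 →₀ ℕ) (x : ℍ[ℝ]) :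
    fueter ν x = ((ν.degree ! : ℝ)⁻¹ * (∏ k, (ν k)! : ℕ)) •
      MvPowerSeries.coeff ν (zetaSeries x ^ ν.degree) := by
  let L : List (Fin 3) :=
    List.replicate (ν 0) 0 ++ List.replicate (ν 1) 1 ++ List.replicate (ν 2) 2
  have hl : List.replicate (ν 0) (zeta 0 x) ++ List.replicate (ν 1) (zeta 1 x) ++
      List.replicate (ν 2) (zeta 2 x) = L.map fun k => zeta k x := by
    simp [L]
  have hlen : L.length = ν.degree := by
    simp [L, Finsupp.degree_eq_sum, Fin.sum_univ_three, add_assoc]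
  have hlen' : (L.map fun k => zeta k x).length = L.length := List.length_map _
  rw [fueter, hl, symProd_eq_coeff (ν := ν) (fun i => L.get (i.cast hlen')), hlen', hlen]
  · intro i
    simp
  · refine (Fintype.sum_equiv (finCongr hlen') _
      (fun i => (single (L.get i) 1 : Fin 3 →₀ ℕ)) fun i => rfl).trans ?_
    simp only [List.get_eq_getElem]
    rw [Fin.sum_univ_fun_getElem L fun k => (single k 1 : Fin 3 →₀ ℕ)]
    ext k
    fin_cases k <;> simp [L]

@[simp] theorem fueter_zero (x : ℍ[ℝ]) : fueter 0 x = 1 := by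
  simp [fueter_eq_coeff]

theorem norm_coeff_zetaSeries_pow_le (n : ℕ) : ∀ (ν : Fin 3 →₀ ℕ) (x : ℍ[ℝ]),
    ‖MvPowerSeries.coeff ν (zetaSeries x ^ n)‖ ≤ (6 * ‖x‖) ^ n := by
  induction n with
  | zero =>
    intro ν x
    rw [pow_zero, pow_zero, MvPowerSeries.coeff_one]
    split_ifs <;> simp
  | succ n ih =>
    intro ν x
    rw [pow_succ', coeff_zetaSeries_mul]
    calc _ ≤ ∑ k : Fin 3, 2 * ‖x‖ * (6 * ‖x‖) ^ n := by
          refine norm_sum_le_of_le _ fun k _ => ?_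
          split_ifs
          · rw [norm_mul]
            gcongr
            exacts [norm_zeta_le k x, ih _ _]
          · rw [norm_zero]; positivity
      _ = _ := by simp; ring

theorem prod_factorial_le (ν : Fin 3 →₀ ℕ) : ∏ k, (ν k)! ≤ ν.degree ! := by
  rw [Finsupp.degree_eq_sum]
  exact Nat.le_of_dvd (Nat.factorial_pos _) (Nat.prod_factorial_dvd_factorial_sum _ _)

theorem norm_fueter_le (ν : Fin 3 →₀ ℕ) (x : ℍ[ℝ]) : ‖fueter ν x‖ ≤ (6 * ‖x‖) ^ ν.degree := by
  rw [fueter_eq_coeff, norm_smul, Real.norm_of_nonneg (by positivity)]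
  have h1 : ((ν.degree ! : ℝ)⁻¹ * (∏ k, (ν k)! : ℕ)) ≤ 1 := by
    rw [inv_mul_le_one₀ (by positivity)]
    exact_mod_cast prod_factorial_le ν
  exact (mul_le_of_le_one_left (norm_nonneg _) h1).trans (norm_coeff_zetaSeries_pow_le _ _ _)

/-- The derivative `∑ₖ νₖ (dζₖ) ζ^(ν - δₖ)` of the Fueter polynomial `ζ^ν`, where `δₖ` is the unit
multi-index. For `νₖ = 0` the truncated subtraction is harmless, as the term is multiplied by `νₖ`. -/
def fueterDeriv (ν : Fin 3 →₀ ℕ) (x : ℍ[ℝ]) : ℍ[ℝ] →L[ℝ] ℍ[ℝ] :=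
  ∑ k, (ν k : ℝ) • MulOpposite.op (fueter (ν - single k 1) x) • zetaL k

theorem fueterDeriv_apply (ν : Fin 3 →₀ ℕ) (x v : ℍ[ℝ]) :
    fueterDeriv ν x v = ∑ k, (ν k : ℝ) • (zeta k v * fueter (ν - single k 1) x) := by
  simp [fueterDeriv, _root_.sum_apply]

theorem hasFDerivAt_fueter (ν : Fin 3 →₀ ℕ) (x : ℍ[ℝ]) :
    HasFDerivAt (fueter ν) (fueterDeriv ν x) x := by
  obtain ⟨L, hL, hLv⟩ := hasFDerivAt_coeff_zetaSeries_pow ν.degree ν x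
  have h := hL.const_smul ((ν.degree ! : ℝ)⁻¹ * (∏ k, (ν k)! : ℕ))
  rw [show fueter ν = _ from funext (fueter_eq_coeff ν)]
  convert! h using 1
  ext1 v
  rw [fueterDeriv_apply, _root_.smul_apply, hLv, coeff_zetaSeries_mul, smul_sum,
    smul_sum]
  refine sum_congr rfl fun k _ => ?_
  split_ifs with hk
  · rw [Finsupp.single_le_iff] at hk
    have hdeg : (ν - single k 1).degree + 1 = ν.degree := by
      have : ν - single k 1 + single k 1 = ν := tsub_add_cancel_of_le (Finsupp.single_le_iff.2 hk)
      conv_rhs => rw [← this]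
      simp
    have hprod : ∏ j, (ν j)! = ν k * ∏ j, ((ν - single k 1 : Fin 3 →₀ ℕ) j)! := by
      rw [← mul_prod_erase univ _ (mem_univ k), ← mul_prod_erase univ _ (mem_univ k), ← mul_assoc]
      congr 1
      · simp [Nat.mul_factorial_pred (by omega : ν k ≠ 0)]
      · refine prod_congr rfl fun j hj => ?_
        simp [(ne_of_mem_erase hj).symm]
    rw [fueter_eq_coeff (ν - single k 1), ← hdeg, Nat.add_sub_cancel, hprod,
      ← Nat.cast_smul_eq_nsmul ℝ, mul_smul_comm, smul_smul, smul_smul]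
    congr 1
    rw [Nat.factorial_succ]
    have := Nat.factorial_ne_zero (ν - single k 1).degree
    push_cast
    field_simp
  · rw [Finsupp.single_le_iff] at hk
    simp [show ν k = 0 by omega]

end Hyperholomorphic

end

/-! ### Convergent power series and their Fueter series -/

noncomputable section

namespace Hyperholomorphic

open Finset Filter
open Finsupp (single)
open MvPowerSeries (coeff)

theorem summable_pow_degree {q : ℝ} (h0 : 0 ≤ q) (h1 : q < 1) :
    Summable fun ν : Fin 3 →₀ ℕ => q ^ ν.degree := by
  have hs := summable_geometric_of_lt_one h0 h1
  have h0' : 0 ≤ fun n : ℕ => q ^ n := fun n => pow_nonneg h0 n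
  have h2 := hs.mul_of_nonneg hs h0' h0'
  have h3 := hs.mul_of_nonneg h2 h0' (fun p => mul_nonneg (h0' _) (h0' _))
  have hinj : Function.Injective fun ν : Fin 3 →₀ ℕ => (ν 0, ν 1, ν 2) := fun ν μ h => by
    simp only [Prod.mk.injEq] at h
    ext k
    fin_cases k
    exacts [h.1, h.2.1, h.2.2]
  refine (h3.comp_injective hinj).congr fun ν => ?_
  simp only [Function.comp, Finsupp.degree_eq_sum, Fin.sum_univ_three]
  ring

/-- A convergent power series: its coefficients grow at most geometrically. -/
def IsConv (c : MvPowerSeries (Fin 3) ℍ[ℝ]) : Prop :=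
  ∃ C r : ℝ, 0 < r ∧ ∀ ν, ‖coeff ν c‖ ≤ C * r ^ ν.degree

theorem IsConv.add {c d : MvPowerSeries (Fin 3) ℍ[ℝ]} (hc : IsConv c) (hd : IsConv d) :
    IsConv (c + d) := by
  obtain ⟨C, r, hr, h⟩ := hc
  obtain ⟨C', r', hr', h'⟩ := hd
  have hC : 0 ≤ C := by simpa using (norm_nonneg _).trans (h 0)
  have hC' : 0 ≤ C' := by simpa using (norm_nonneg _).trans (h' 0)
  refine ⟨C + C', max r r', lt_max_of_lt_left hr, fun ν => ?_⟩
  rw [map_add, add_mul]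
  refine (norm_add_le _ _).trans (add_le_add ((h ν).trans ?_) ((h' ν).trans ?_))
  · gcongr
    exact le_max_left _ _
  · gcongr
    exact le_max_right _ _

theorem IsConv.neg {c : MvPowerSeries (Fin 3) ℍ[ℝ]} (hc : IsConv c) : IsConv (-c) := by
  obtain ⟨C, r, hr, h⟩ := hc
  exact ⟨C, r, hr, fun ν => by simpa using h ν⟩

theorem isConv_monomial (ν : Fin 3 →₀ ℕ) (a : ℍ[ℝ]) : IsConv (MvPowerSeries.monomial ν a) := by
  refine ⟨‖a‖, 1, one_pos, fun μ => ?_⟩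
  rw [MvPowerSeries.coeff_monomial]
  split_ifs <;> simp

theorem antidiagonal_degree {ν : Fin 3 →₀ ℕ} {p : (Fin 3 →₀ ℕ) × (Fin 3 →₀ ℕ)}
    (hp : p ∈ antidiagonal ν) : p.1.degree + p.2.degree = ν.degree := by
  rw [← mem_antidiagonal.1 hp, map_add]

theorem sum_antidiagonal_le_tsum {u : (Fin 3 →₀ ℕ) → ℝ} (hu : Summable u) (h0 : ∀ ν, 0 ≤ u ν)
    (ν : Fin 3 →₀ ℕ) : ∑ p ∈ antidiagonal ν, u p.1 ≤ ∑' μ, u μ := by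
  have hinj : Set.InjOn Prod.fst (antidiagonal ν : Set ((Fin 3 →₀ ℕ) × (Fin 3 →₀ ℕ))) :=
    fun p hp q hq h => by
      have hp := mem_antidiagonal.1 (mem_coe.1 hp)
      have hq := mem_antidiagonal.1 (mem_coe.1 hq)
      refine Prod.ext h (add_left_cancel (a := p.1) ?_)
      rw [hp, h, hq]
  rw [← sum_image (f := u) hinj]
  exact hu.sum_le_tsum _ fun _ _ => h0 _

theorem IsConv.mul {c d : MvPowerSeries (Fin 3) ℍ[ℝ]} (hc : IsConv c) (hd : IsConv d) :
    IsConv (c * d) := by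
  obtain ⟨C, r, hr, h⟩ := hc
  obtain ⟨C', r', hr', h'⟩ := hd
  have hC : 0 ≤ C := by simpa using (norm_nonneg _).trans (h 0)
  have hC' : 0 ≤ C' := by simpa using (norm_nonneg _).trans (h' 0)
  set R := max (2 * r) r' with hR
  have hR0 : 0 < R := lt_max_of_lt_right hr'
  have hsum := summable_pow_degree (q := 1 / 2) (by norm_num) (by norm_num)
  refine ⟨C * C' * ∑' μ : Fin 3 →₀ ℕ, (1 / 2) ^ μ.degree, R, hR0, fun ν => ?_⟩
  rw [MvPowerSeries.coeff_mul]
  calc ‖∑ p ∈ antidiagonal ν, coeff p.1 c * coeff p.2 d‖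
      ≤ ∑ p ∈ antidiagonal ν, C * C' * R ^ ν.degree * (1 / 2) ^ p.1.degree := by
        refine norm_sum_le_of_le _ fun p hp => ?_
        rw [norm_mul, ← antidiagonal_degree hp]
        calc _ ≤ (C * r ^ p.1.degree) * (C' * r' ^ p.2.degree) :=
              mul_le_mul (h _) (h' _) (norm_nonneg _) (by positivity)
          _ ≤ (C * (R * (1 / 2)) ^ p.1.degree) * (C' * R ^ p.2.degree) := by
              gcongr
              · linarith [le_max_left (2 * r) r']
              · exact le_max_right _ _
          _ = _ := by rw [mul_pow, pow_add]; ring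
    _ ≤ C * C' * R ^ ν.degree * ∑' μ : Fin 3 →₀ ℕ, (1 / 2) ^ μ.degree := by
        rw [← mul_sum]
        gcongr
        exact sum_antidiagonal_le_tsum hsum (fun _ => by positivity) ν
    _ = _ := by ring

/-- A right inverse of a convergent power series is convergent. -/
theorem IsConv.of_mul_eq_one {c s : MvPowerSeries (Fin 3) ℍ[ℝ]} (hc : IsConv c) (h1 : c * s = 1) :
    IsConv s := by
  obtain ⟨C, r, hr, h⟩ := hc
  have hC : 0 ≤ C := by simpa using (norm_nonneg _).trans (h 0)
  have h00 : coeff 0 c * coeff 0 s = 1 := by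
    have := congrArg (coeff 0) h1
    rwa [MvPowerSeries.coeff_mul, Finsupp.antidiagonal_zero, sum_singleton,
      MvPowerSeries.coeff_zero_one] at this
  have hc0 : coeff 0 c ≠ 0 := left_ne_zero_of_mul_eq_one h00
  have hs0 : coeff 0 s = (coeff 0 c)⁻¹ := eq_inv_of_mul_eq_one_right h00
  set K := ‖(coeff 0 c)⁻¹‖ with hK
  have hsum := summable_pow_degree (q := 1 / 2) (by norm_num) (by norm_num)
  set S := ∑' μ : Fin 3 →₀ ℕ, (1 / 2 : ℝ) ^ μ.degree with hS
  have hS0 : 0 ≤ S := tsum_nonneg fun _ => by positivity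
  have hK0 : 0 ≤ K := norm_nonneg _
  -- The factor `T` makes the contribution of the nonconstant coefficients of `c` a contraction.
  set T := 1 + K * C * S with hT
  have hT1 : 1 ≤ T := by rw [hT]; linarith [mul_nonneg (mul_nonneg hK0 hC) hS0]
  have hT0 : 0 < T := by linarith
  set R := 2 * r * T with hR
  have hR0 : 0 < R := by positivity
  suffices ∀ n, ∀ ν : Fin 3 →₀ ℕ, ν.degree = n → ‖coeff ν s‖ ≤ K * R ^ ν.degree from
    ⟨K, R, hR0, fun ν => this _ ν rfl⟩
  intro n
  induction n using Nat.strong_induction_on with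
  | _ n ih =>
  intro ν hν
  rcases eq_or_ne ν 0 with rfl | hν0
  · simp [hs0, hK]
  have hmem : ((0 : Fin 3 →₀ ℕ), ν) ∈ antidiagonal ν := by simp
  have h2 : coeff 0 c * coeff ν s = -∑ p ∈ (antidiagonal ν).erase (0, ν),
      coeff p.1 c * coeff p.2 s := by
    have := congrArg (coeff ν) h1
    rw [MvPowerSeries.coeff_mul, ← add_sum_erase _ _ hmem, MvPowerSeries.coeff_one,
      if_neg hν0] at this
    exact eq_neg_of_add_eq_zero_left this
  have h3 : coeff ν s = -((coeff 0 c)⁻¹ * ∑ p ∈ (antidiagonal ν).erase (0, ν),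
      coeff p.1 c * coeff p.2 s) := by
    rw [← mul_neg, ← h2, inv_mul_cancel_left₀ hc0]
  rw [h3, norm_neg, norm_mul]
  gcongr
  calc ‖∑ p ∈ (antidiagonal ν).erase (0, ν), coeff p.1 c * coeff p.2 s‖
      ≤ ∑ p ∈ (antidiagonal ν).erase (0, ν), K * C * R ^ ν.degree * T⁻¹ * (1 / 2) ^ p.1.degree := by
        refine norm_sum_le_of_le _ fun p hp => ?_
        have hp' := mem_of_mem_erase hp
        have hd := antidiagonal_degree hp'
        have hp1 : p.1.degree ≠ 0 := fun h0 => by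
          rw [Finsupp.degree_eq_zero_iff] at h0
          refine ne_of_mem_erase hp (Prod.ext h0 ?_)
          simpa [h0] using mem_antidiagonal.1 hp'
        rw [norm_mul, ← hd]
        calc _ ≤ (C * r ^ p.1.degree) * (K * R ^ p.2.degree) :=
              mul_le_mul (h _) (ih _ (by omega) _ rfl) (norm_nonneg _) (by positivity)
          _ = K * C * (R ^ p.2.degree) * (R ^ p.1.degree * (T⁻¹ * (1 / 2)) ^ p.1.degree) := by
              rw [← mul_pow, show R * (T⁻¹ * (1 / 2)) = r by rw [hR]; field_simp]
              ring
          _ ≤ K * C * (R ^ p.2.degree) * (R ^ p.1.degree * (T⁻¹ * (1 / 2) ^ p.1.degree)) := by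
              rw [mul_pow T⁻¹]
              gcongr
              exact pow_le_of_le_one (by positivity) (inv_le_one_of_one_le₀ hT1) hp1
          _ = _ := by rw [pow_add]; ring
    _ ≤ ∑ p ∈ antidiagonal ν, K * C * R ^ ν.degree * T⁻¹ * (1 / 2) ^ p.1.degree :=
        sum_le_sum_of_subset_of_nonneg (erase_subset _ _) fun _ _ _ => by positivity
    _ ≤ K * C * R ^ ν.degree * T⁻¹ * S := by
        rw [← mul_sum]
        gcongr
        exact sum_antidiagonal_le_tsum hsum (fun _ => by positivity) ν
    _ = (K * C * S * T⁻¹) * R ^ ν.degree := by ring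
    _ ≤ 1 * R ^ ν.degree := by
        gcongr
        rw [← div_eq_mul_inv, div_le_one hT0]
        linarith
    _ = R ^ ν.degree := one_mul _

theorem sum_apply_eq_degree (ν : Fin 3 →₀ ℕ) : ∑ k, (ν k : ℝ) = ν.degree := by
  rw [Finsupp.degree_eq_sum]; push_cast; rfl

theorem degree_sub_single {ν : Fin 3 →₀ ℕ} {k : Fin 3} (h : ν k ≠ 0) :
    (ν - single k 1).degree + 1 = ν.degree := by
  have h' : ν - single k 1 + single k 1 = ν :=
    tsub_add_cancel_of_le (Finsupp.single_le_iff.2 (Nat.one_le_iff_ne_zero.2 h))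
  conv_rhs => rw [← h']
  simp

theorem norm_fueterDeriv_le {ρ : ℝ} (hρ : 0 < ρ) (ν : Fin 3 →₀ ℕ) {x : ℍ[ℝ]} (hx : ‖x‖ ≤ ρ) :
    ‖fueterDeriv ν x‖ ≤ 2 / (6 * ρ) * (2 * (6 * ρ)) ^ ν.degree := by
  refine ContinuousLinearMap.opNorm_le_bound _ (by positivity) fun v => ?_
  rw [fueterDeriv_apply]
  calc _ ≤ ∑ k, (ν k : ℝ) * (2 * ‖v‖ * ((6 * ρ) ^ ν.degree / (6 * ρ))) := by
        refine norm_sum_le_of_le _ fun k _ => ?_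
        rw [norm_smul, norm_mul, Real.norm_of_nonneg (by positivity)]
        rcases eq_or_ne (ν k) 0 with h | h
        · simp [h]
        · gcongr
          · exact norm_zeta_le k v
          · refine (norm_fueter_le _ _).trans ?_
            rw [← degree_sub_single h, pow_succ, mul_div_cancel_right₀ _ (by positivity)]
            gcongr
    _ = ν.degree * (2 * ‖v‖ * ((6 * ρ) ^ ν.degree / (6 * ρ))) := by
        rw [← sum_mul, sum_apply_eq_degree]
    _ ≤ 2 ^ ν.degree * (2 * ‖v‖ * ((6 * ρ) ^ ν.degree / (6 * ρ))) := by
        gcongr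
        exact_mod_cast Nat.lt_two_pow_self.le
    _ = _ := by rw [mul_pow 2 (6 * ρ)]; ring

theorem norm_op_smul_le (a : ℍ[ℝ]) (D : ℍ[ℝ] →L[ℝ] ℍ[ℝ]) :
    ‖MulOpposite.op a • D‖ ≤ ‖a‖ * ‖D‖ :=
  ContinuousLinearMap.opNorm_le_bound _ (by positivity) fun v => by
    rw [_root_.smul_apply, op_smul_eq_mul, norm_mul, mul_comm, mul_assoc]
    gcongr
    exact D.le_opNorm v

theorem exists_hasFDerivAt_tsum {α E F : Type*} [NormedAddCommGroup E] [NormedSpace ℝ E]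
    [NormedAddCommGroup F] [NormedSpace ℝ F] [CompleteSpace F] {u : α → ℝ} (hu : Summable u)
    {s : Set E} (hs : IsOpen s) (h's : IsPreconnected s) {f : α → E → F} {f' : α → E → E →L[ℝ] F}
    (hf : ∀ n x, x ∈ s → HasFDerivAt (f n) (f' n x) x) (hf' : ∀ n x, x ∈ s → ‖f' n x‖ ≤ u n)
    {x₀ x : E} (hx₀ : x₀ ∈ s) (hf0 : Summable fun n => f n x₀) (hx : x ∈ s) :
    ∃ L : E →L[ℝ] F, HasFDerivAt (fun y => ∑' n, f n y) L x ∧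
      ∀ v, HasSum (fun n => f' n x v) (L v) :=
  ⟨_, hasFDerivAt_tsum_of_isPreconnected hu hs h's hf hf' hx₀ hf0 hx, fun v =>
    (Summable.of_norm_bounded hu fun n => hf' n x hx).hasSum.mapL
      (ContinuousLinearMap.apply ℝ F v)⟩

/-- Termwise differentiation of a convergent Fueter series. -/
theorem IsConv.hasFDerivAt_fueterSum {c : MvPowerSeries (Fin 3) ℍ[ℝ]} (hc : IsConv c) :
    ∀ᶠ x in 𝓝 (0 : ℍ[ℝ]), ∃ L : ℍ[ℝ] →L[ℝ] ℍ[ℝ], HasFDerivAt (fueterSum c) L x ∧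
      ∀ v, HasSum (fun ν => fueterDeriv ν x v * coeff ν c) (L v) := by
  obtain ⟨C, r, hr, h⟩ := hc
  have hC : 0 ≤ C := by simpa using (norm_nonneg _).trans (h 0)
  -- On the ball of this radius the derivatives of the terms are dominated by `(1 / 2) ^ |ν|`.
  set ρ := 1 / (24 * r) with hρd
  have hρ : 0 < ρ := by positivity
  have hρr : 2 * (6 * ρ) * r = 1 / 2 := by rw [hρd]; field_simp; norm_num
  have hρr' : 6 * ρ * r = 1 / 4 := by linarith
  have hbound : ∀ ν : Fin 3 →₀ ℕ, ∀ x ∈ Metric.ball (0 : ℍ[ℝ]) ρ,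
      ‖MulOpposite.op (coeff ν c) • fueterDeriv ν x‖ ≤ C * (2 / (6 * ρ)) * (1 / 2) ^ ν.degree := by
    intro ν x hx
    refine (norm_op_smul_le _ _).trans ?_
    calc _ ≤ (C * r ^ ν.degree) * (2 / (6 * ρ) * (2 * (6 * ρ)) ^ ν.degree) :=
          mul_le_mul (h ν) (norm_fueterDeriv_le hρ ν (mem_ball_zero_iff.1 hx).le)
            (ContinuousLinearMap.opNorm_nonneg _) (by positivity)
      _ = _ := by rw [← hρr, mul_pow _ r]; ring
  have hsum : Summable fun ν : Fin 3 →₀ ℕ => C * (2 / (6 * ρ)) * (1 / 2) ^ ν.degree :=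
    (summable_pow_degree (by norm_num) (by norm_num)).mul_left _
  have h0 : Summable fun ν : Fin 3 →₀ ℕ => fueter ν 0 * coeff ν c := by
    refine summable_of_ne_finset_zero (s := {0}) fun ν hν => ?_
    have : ‖fueter ν 0‖ ≤ 0 := by
      refine (norm_fueter_le ν 0).trans ?_
      rw [norm_zero, mul_zero, zero_pow]
      rw [Ne, Finsupp.degree_eq_zero_iff]
      simpa using hν
    rw [norm_le_zero_iff.1 this, zero_mul]
  have hterm : ∀ ν : Fin 3 →₀ ℕ, ∀ x ∈ Metric.ball (0 : ℍ[ℝ]) ρ,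
      HasFDerivAt (fun y => fueter ν y * coeff ν c)
        (MulOpposite.op (coeff ν c) • fueterDeriv ν x) x :=
    fun ν x _ => (hasFDerivAt_fueter ν x).mul_const' (coeff ν c)
  filter_upwards [Metric.ball_mem_nhds (0 : ℍ[ℝ]) hρ] with x hx
  obtain ⟨L, hL, hLs⟩ := exists_hasFDerivAt_tsum hsum Metric.isOpen_ball
    (convex_ball (0 : ℍ[ℝ]) ρ).isPreconnected hterm hbound (Metric.mem_ball_self hρ) h0 hx
  refine ⟨L, hL, fun v => ?_⟩
  have h1 := hLs v
  simp only [_root_.smul_apply, op_smul_eq_mul] at h1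
  exact h1

theorem fueterDeriv_e (ν : Fin 3 →₀ ℕ) (x : ℍ[ℝ]) (k : Fin 3) :
    fueterDeriv ν x (e k) = (ν k : ℝ) • fueter (ν - single k 1) x := by
  rw [fueterDeriv_apply, sum_eq_single k]
  · simp [zeta_e]
  · intro j _ hj
    simp [zeta_e, hj]
  · simp

/-- The Fueter polynomials are left-hyperholomorphic. -/
theorem fueterDeriv_one_add_sum_e (ν : Fin 3 →₀ ℕ) (x : ℍ[ℝ]) :
    fueterDeriv ν x 1 + ∑ k, e k * fueterDeriv ν x (e k) = 0 := by
  simp only [fueterDeriv_e]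
  rw [fueterDeriv_apply, ← sum_add_distrib]
  exact sum_eq_zero fun k _ => by simp [zeta_one]

/-- A convergent Fueter series is left-hyperholomorphic. -/
theorem IsConv.fueterSum_mem_HypO {c : MvPowerSeries (Fin 3) ℍ[ℝ]} (hc : IsConv c) :
    fueterSum c ∈ HypO := by
  filter_upwards [hc.hasFDerivAt_fueterSum] with x ⟨L, hL, hs⟩
  refine ⟨hL.differentiableAt, ?_⟩
  simp only [cauchyFueter, pderiv, hL.fderiv]
  have h1 : HasSum (fun ν => (fueterDeriv ν x 1 + ∑ k, e k * fueterDeriv ν x (e k)) * coeff ν c)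
      (L 1 + ∑ k, e k * L (e k)) := by
    simp only [add_mul, sum_mul, mul_assoc]
    exact (hs 1).add (hasSum_sum fun k _ => (hs (e k)).mul_left (e k))
  simp only [fueterDeriv_one_add_sum_e, zero_mul] at h1
  exact h1.unique hasSum_zero

/-- The formal partial derivative of a power series with respect to the `k`-th variable. -/
def derivSeries (k : Fin 3) (c : MvPowerSeries (Fin 3) ℍ[ℝ]) : MvPowerSeries (Fin 3) ℍ[ℝ] :=
  fun ν => (ν k + 1 : ℝ) • coeff (ν + single k 1) c

theorem coeff_derivSeries (k : Fin 3) (c : MvPowerSeries (Fin 3) ℍ[ℝ]) (ν : Fin 3 →₀ ℕ) :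
    coeff ν (derivSeries k c) = (ν k + 1 : ℝ) • coeff (ν + single k 1) c := rfl

theorem IsConv.derivSeries {c : MvPowerSeries (Fin 3) ℍ[ℝ]} (hc : IsConv c) (k : Fin 3) :
    IsConv (derivSeries k c) := by
  obtain ⟨C, r, hr, h⟩ := hc
  have hC : 0 ≤ C := by simpa using (norm_nonneg _).trans (h 0)
  refine ⟨C * r, 2 * r, by positivity, fun ν => ?_⟩
  rw [coeff_derivSeries, norm_smul, Real.norm_of_nonneg (by positivity)]
  have h1 : (ν k + 1 : ℝ) ≤ 2 ^ ν.degree := by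
    have h2 := Finsupp.le_degree k ν
    have h3 : ν.degree + 1 ≤ 2 ^ ν.degree := Nat.lt_two_pow_self
    exact_mod_cast (by omega : ν k + 1 ≤ 2 ^ ν.degree)
  calc _ ≤ 2 ^ ν.degree * (C * r ^ (ν + single k 1).degree) :=
        mul_le_mul h1 (h _) (norm_nonneg _) (by positivity)
    _ = _ := by rw [map_add, Finsupp.degree_single, pow_succ, mul_pow]; ring

theorem IsConv.pderiv_fueterSum {c : MvPowerSeries (Fin 3) ℍ[ℝ]} (hc : IsConv c) (k : Fin 3) :
    pderiv k (fueterSum c) =ᶠ[𝓝 0] fueterSum (Hyperholomorphic.derivSeries k c) := by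
  filter_upwards [hc.hasFDerivAt_fueterSum] with x ⟨L, hL, hs⟩
  rw [pderiv, hL.fderiv, ← (hs (e k)).tsum_eq, fueterSum]
  have hinj : Function.Injective fun ν : Fin 3 →₀ ℕ => ν + single k 1 := add_left_injective _
  rw [← hinj.tsum_eq]
  · refine tsum_congr fun ν => ?_
    simp [fueterDeriv_e, coeff_derivSeries]
  · intro ν hν
    have h0 : ν k ≠ 0 := fun h0 => hν (by simp [fueterDeriv_e, h0])
    exact ⟨ν - single k 1,
      tsub_add_cancel_of_le (Finsupp.single_le_iff.2 (Nat.one_le_iff_ne_zero.2 h0))⟩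

theorem pderiv_congr {f g : ℍ[ℝ] → ℍ[ℝ]} (h : f =ᶠ[𝓝 0] g) (k : Fin 3) :
    pderiv k f =ᶠ[𝓝 0] pderiv k g :=
  (h.fderiv (𝕜 := ℝ)).mono fun x hx => by simp only [pderiv, hx]

theorem pderiv_iterate_congr {f g : ℍ[ℝ] → ℍ[ℝ]} (h : f =ᶠ[𝓝 0] g) (k : Fin 3) (j : ℕ) :
    (pderiv k)^[j] f =ᶠ[𝓝 0] (pderiv k)^[j] g := by
  induction j generalizing f g with
  | zero => exact h
  | succ j ih => exact ih (pderiv_congr h k)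

theorem coeffs_congr {f g : ℍ[ℝ] → ℍ[ℝ]} (h : f =ᶠ[𝓝 0] g) : coeffs f = coeffs g := by
  funext ν
  simp only [coeffs]
  rw [(pderiv_iterate_congr (pderiv_iterate_congr
    (pderiv_iterate_congr h 2 (ν 2)) 1 (ν 1)) 0 (ν 0)).eq_of_nhds]

theorem IsConv.pderiv_iterate_fueterSum {c : MvPowerSeries (Fin 3) ℍ[ℝ]} (hc : IsConv c) (k : Fin 3)
    (j : ℕ) : IsConv ((Hyperholomorphic.derivSeries k)^[j] c) ∧
      (pderiv k)^[j] (fueterSum c) =ᶠ[𝓝 0] fueterSum ((Hyperholomorphic.derivSeries k)^[j] c) := by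
  induction j generalizing c with
  | zero => exact ⟨hc, .rfl⟩
  | succ j ih =>
    obtain ⟨h1, h2⟩ := ih (hc.derivSeries k)
    exact ⟨h1, (pderiv_iterate_congr (hc.pderiv_fueterSum k) k j).trans h2⟩

theorem coeff_derivSeries_iterate (k : Fin 3) (j : ℕ) (c : MvPowerSeries (Fin 3) ℍ[ℝ])
    (ν : Fin 3 →₀ ℕ) : coeff ν ((derivSeries k)^[j] c) =
      ((ν k + j)! / (ν k)! : ℝ) • coeff (ν + single k j) c := by
  induction j generalizing ν with
  | zero => simp [div_self (Nat.cast_ne_zero.2 (Nat.factorial_ne_zero (ν k)) : ((ν k)! : ℝ) ≠ 0)]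
  | succ j ih =>
    rw [Function.iterate_succ_apply', coeff_derivSeries, ih, smul_smul, add_assoc,
      ← Finsupp.single_add, add_comm 1 j]
    congr 1
    have := Nat.factorial_ne_zero (ν k)
    simp only [Finsupp.add_apply, Finsupp.single_eq_same, Nat.factorial_succ,
      show ν k + 1 + j = ν k + (j + 1) by ring]
    push_cast
    field_simp

theorem fueterSum_apply_zero (c : MvPowerSeries (Fin 3) ℍ[ℝ]) : fueterSum c 0 = coeff 0 c := by
  rw [fueterSum, tsum_eq_single 0]
  · simp
  · intro ν hν
    have : ‖fueter ν 0‖ ≤ 0 := by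
      refine (norm_fueter_le ν 0).trans ?_
      rw [norm_zero, mul_zero, zero_pow]
      rwa [Ne, Finsupp.degree_eq_zero_iff]
    rw [norm_le_zero_iff.1 this, zero_mul]

/-- A convergent Fueter series determines its coefficients. -/
theorem IsConv.coeffs_fueterSum {c : MvPowerSeries (Fin 3) ℍ[ℝ]} (hc : IsConv c) :
    coeffs (fueterSum c) = c := by
  funext ν
  obtain ⟨c2, h2⟩ := hc.pderiv_iterate_fueterSum 2 (ν 2)
  obtain ⟨c1, h1⟩ := c2.pderiv_iterate_fueterSum 1 (ν 1)
  obtain ⟨c0, h0⟩ := c1.pderiv_iterate_fueterSum 0 (ν 0)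
  have := ((pderiv_iterate_congr (pderiv_iterate_congr h2 1 (ν 1)) 0 (ν 0)).trans
    ((pderiv_iterate_congr h1 0 (ν 0)).trans h0)).eq_of_nhds
  simp only [coeffs]
  rw [this, fueterSum_apply_zero, coeff_derivSeries_iterate, coeff_derivSeries_iterate,
    coeff_derivSeries_iterate, smul_smul, smul_smul, smul_smul]
  have h3 : (0 : Fin 3 →₀ ℕ) + single 0 (ν 0) + single 1 (ν 1) + single 2 (ν 2) = ν := by
    ext k
    fin_cases k <;> simp
  rw [h3]
  have h4 := Nat.factorial_ne_zero (ν 0)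
  have h5 := Nat.factorial_ne_zero (ν 1)
  have h6 := Nat.factorial_ne_zero (ν 2)
  simp
  convert! one_smul ℝ (coeff ν c)
  field_simp

end Hyperholomorphic

end

/-! ### Iterated directional derivatives of analytic functions -/

noncomputable section

namespace Hyperholomorphic

open Filter

theorem foldr_replicate_eq_iterate {α β : Type*} (f : α → β → β) (a : α) (n : ℕ) (b : β) :
    (List.replicate n a).foldr f b = (f a)^[n] b := by
  induction n with
  | zero => rfl
  | succ n ih => rw [List.replicate_succ, List.foldr_cons, Function.iterate_succ_apply', ih]

section DirectionalDerivatives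

variable {E F : Type*} [NormedAddCommGroup E] [NormedSpace ℝ E] [NormedAddCommGroup F]
  [NormedSpace ℝ F]

/-- The derivative of `g` in the direction `v`. For a list `l` of vectors, `l.foldr dirDeriv g` is the
iterated directional derivative, the last vector of `l` acting first. -/
def dirDeriv (v : E) (g : E → F) : E → F := fun x => fderiv ℝ g x v

theorem dirDeriv_congr {f g : E → F} {a : E} (h : f =ᶠ[𝓝 a] g) (v : E) :
    dirDeriv v f =ᶠ[𝓝 a] dirDeriv v g :=
  (h.fderiv (𝕜 := ℝ)).mono fun x hx => by simp only [dirDeriv, hx]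

theorem dirDeriv_add {f g : E → F} {a : E} (hf : ∀ᶠ x in 𝓝 a, DifferentiableAt ℝ f x)
    (hg : ∀ᶠ x in 𝓝 a, DifferentiableAt ℝ g x) (v : E) :
    dirDeriv v (f + g) =ᶠ[𝓝 a] dirDeriv v f + dirDeriv v g := by
  filter_upwards [hf, hg] with x h1 h2
  simp only [dirDeriv, fderiv_add h1 h2, Pi.add_apply, add_apply]

variable [CompleteSpace F]

theorem analyticAt_dirDeriv {g : E → F} {a : E} (hg : AnalyticAt ℝ g a) (v : E) :
    AnalyticAt ℝ (dirDeriv v g) a :=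
  ((ContinuousLinearMap.apply ℝ F v).analyticAt _).comp hg.fderiv

theorem analyticAt_foldr_dirDeriv {g : E → F} {a : E} (hg : AnalyticAt ℝ g a) (l : List E) :
    AnalyticAt ℝ (l.foldr dirDeriv g) a := by
  induction l with
  | nil => exact hg
  | cons v l ih => exact analyticAt_dirDeriv ih v

theorem differentiableAt_of_analyticAt {g : E → F} {a : E} (hg : AnalyticAt ℝ g a) :
    ∀ᶠ x in 𝓝 a, DifferentiableAt ℝ g x :=
  hg.eventually_analyticAt.mono fun _ hx => hx.differentiableAt

theorem dirDeriv_comm {g : E → F} {a : E} (hg : AnalyticAt ℝ g a) (v w : E) :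
    dirDeriv v (dirDeriv w g) =ᶠ[𝓝 a] dirDeriv w (dirDeriv v g) := by
  filter_upwards [hg.eventually_analyticAt] with x hx
  have h : ∀ v w, dirDeriv v (dirDeriv w g) x = fderiv ℝ (fderiv ℝ g) x v w := fun v w => by
    have := ((ContinuousLinearMap.apply ℝ F w).hasFDerivAt.comp x
      hx.fderiv.differentiableAt.hasFDerivAt).fderiv
    exact congrArg (fun L : E →L[ℝ] F => L v) this
  rw [h, h]
  exact (hx.contDiffAt (n := ⊤)).isSymmSndFDerivAt_of_omega v w

theorem foldr_dirDeriv_add {f g : E → F} {a : E} (hf : AnalyticAt ℝ f a) (hg : AnalyticAt ℝ g a)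
    (l : List E) :
    l.foldr dirDeriv (f + g) =ᶠ[𝓝 a] l.foldr dirDeriv f + l.foldr dirDeriv g := by
  induction l with
  | nil => exact .rfl
  | cons v l ih =>
    exact (dirDeriv_congr ih v).trans
      (dirDeriv_add (differentiableAt_of_analyticAt (analyticAt_foldr_dirDeriv hf l))
        (differentiableAt_of_analyticAt (analyticAt_foldr_dirDeriv hg l)) v)

theorem foldr_dirDeriv_dirDeriv {g : E → F} {a : E} (hg : AnalyticAt ℝ g a) (l : List E) (v : E) :
    l.foldr dirDeriv (dirDeriv v g) =ᶠ[𝓝 a] dirDeriv v (l.foldr dirDeriv g) := by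
  induction l with
  | nil => exact .rfl
  | cons w l ih =>
    exact (dirDeriv_congr ih w).trans (dirDeriv_comm (analyticAt_foldr_dirDeriv hg l) w v)

theorem foldr_dirDeriv_perm {g : E → F} {a : E} (hg : AnalyticAt ℝ g a) {l l' : List E}
    (h : l.Perm l') : l.foldr dirDeriv g =ᶠ[𝓝 a] l'.foldr dirDeriv g := by
  induction h with
  | nil => exact .rfl
  | cons v _ ih => exact dirDeriv_congr ih v
  | swap v w l => exact dirDeriv_comm (analyticAt_foldr_dirDeriv hg l) w v
  | trans _ _ ih ih' => exact ih.trans ih'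

theorem foldr_dirDeriv_eq_iteratedFDeriv {g : E → F} {a : E} (hg : AnalyticAt ℝ g a) (l : List E) :
    l.foldr dirDeriv g =ᶠ[𝓝 a] fun x => iteratedFDeriv ℝ l.length g x l.get := by
  induction l with
  | nil => exact .of_forall fun x => by simp
  | cons v l ih =>
    refine (dirDeriv_congr ih v).trans ?_
    filter_upwards [hg.eventually_analyticAt] with x hx
    have hd : DifferentiableAt ℝ (iteratedFDeriv ℝ l.length g) x :=
      (hx.contDiffAt (n := ⊤)).differentiableAt_iteratedFDeriv (by exact_mod_cast WithTop.coe_lt_top _)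
    have h1 := ((ContinuousMultilinearMap.apply ℝ (fun _ : Fin l.length => E) F
      l.get).hasFDerivAt.comp x hd.hasFDerivAt).fderiv
    have h2 := congrArg (fun L : E →L[ℝ] F => L v) h1
    exact h2

/-- Cauchy estimates for the iterated directional derivatives of an analytic function. -/
theorem exists_norm_foldr_dirDeriv_le {g : E → F} {a : E} (hg : AnalyticAt ℝ g a) :
    ∃ C r : ℝ, 0 < r ∧ ∀ l : List E, (∀ v ∈ l, ‖v‖ ≤ 1) →
      ‖l.foldr dirDeriv g a‖ ≤ l.length ! * (C * r ^ l.length) := by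
  obtain ⟨p, R, hp⟩ := hg
  obtain ⟨C, r, hC, hr, h⟩ := p.le_mul_pow_of_radius_pos (hp.r_pos.trans_le hp.r_le)
  refine ⟨C, r, hr, fun l hl => ?_⟩
  rw [(foldr_dirDeriv_eq_iteratedFDeriv ⟨p, R, hp⟩ l).eq_of_nhds,
    hp.iteratedFDeriv_eq_sum_of_completeSpace]
  refine (norm_sum_le_of_le (f := fun σ : Equiv.Perm (Fin l.length) => _)
    (n := fun _ => C * r ^ l.length) _ fun σ _ => ?_).trans_eq ?_
  · refine ((p l.length).le_opNorm _).trans ?_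
    refine (mul_le_of_le_one_right (norm_nonneg _) ?_).trans (h _)
    exact Finset.prod_le_one (fun _ _ => norm_nonneg _) fun i _ => hl _ (List.get_mem _ _)
  · simp [Fintype.card_perm]

/-- An analytic function all of whose iterated derivatives along a fixed direction vanish vanishes
locally. -/
theorem eventually_eq_zero_of_iterate_dirDeriv {g : E → F} {a : E} (hg : AnalyticAt ℝ g a)
    (h : ∀ (v : E) (n : ℕ), (dirDeriv v)^[n] g a = 0) : g =ᶠ[𝓝 a] 0 := by
  obtain ⟨p, R, hp⟩ := hg
  have h0 : ∀ (y : E) (n : ℕ), (iteratedFDeriv ℝ n g a fun _ => y) = 0 := fun y n => by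
    have h1 := (foldr_dirDeriv_eq_iteratedFDeriv ⟨p, R, hp⟩ (List.replicate n y)).eq_of_nhds
    rw [foldr_replicate_eq_iterate, h] at h1
    have h3 : ∀ m, m = n → (iteratedFDeriv ℝ m g a fun _ => y) = 0 →
        (iteratedFDeriv ℝ n g a fun _ => y) = 0 := by
      rintro m rfl; exact id
    refine h3 _ (List.length_replicate (a := y)) ?_
    rw [h1]
    congr 1
    ext i
    simp
  filter_upwards [Metric.eball_mem_nhds a hp.r_pos] with x hx
  have hx' : x - a ∈ Metric.eball (0 : E) R := by
    simpa [Metric.mem_eball, edist_eq_enorm_sub] using hx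
  have := hp.hasSum_iteratedFDeriv hx'
  simp only [h0, smul_zero, add_sub_cancel] at this
  exact this.unique hasSum_zero

end DirectionalDerivatives

end Hyperholomorphic

end

/-! ### The Fueter expansion and the ring of germs -/

noncomputable section

namespace Hyperholomorphic

open Filter
open Finsupp (single)
open MvPowerSeries (coeff)

theorem cauchyFueter_congr {f g : ℍ[ℝ] → ℍ[ℝ]} (h : f =ᶠ[𝓝 0] g) :
    cauchyFueter f =ᶠ[𝓝 0] cauchyFueter g :=
  (h.fderiv (𝕜 := ℝ)).mono fun x hx => by simp only [cauchyFueter, pderiv, hx]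

theorem mem_HypO_congr {f g : ℍ[ℝ] → ℍ[ℝ]} (hf : f ∈ HypO) (h : f =ᶠ[𝓝 0] g) : g ∈ HypO := by
  filter_upwards [hf, h.eventuallyEq_nhds, cauchyFueter_congr h] with x hx h1 h2
  exact ⟨hx.1.congr_of_eventuallyEq h1.symm, h2 ▸ hx.2⟩

theorem add_mem_HypO {f g : ℍ[ℝ] → ℍ[ℝ]} (hf : f ∈ HypO) (hg : g ∈ HypO) : f + g ∈ HypO := by
  filter_upwards [hf, hg] with x ⟨h1, h2⟩ ⟨h3, h4⟩
  refine ⟨h1.add h3, ?_⟩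
  have : cauchyFueter (f + g) x = cauchyFueter f x + cauchyFueter g x := by
    simp only [cauchyFueter_eq_sum, fderiv_add h1 h3, add_apply, mul_add, Finset.sum_add_distrib]
  rw [this, h2, h4, add_zero]

theorem neg_mem_HypO {f : ℍ[ℝ] → ℍ[ℝ]} (hf : f ∈ HypO) : -f ∈ HypO := by
  filter_upwards [hf] with x ⟨h1, h2⟩
  refine ⟨h1.neg, ?_⟩
  have : cauchyFueter (-f) x = -cauchyFueter f x := by
    simp only [cauchyFueter_eq_sum, fderiv_neg, neg_apply, mul_neg, Finset.sum_neg_distrib]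
  rw [this, h2, neg_zero]

/-- The letters `0, 1, 2` in increasing order, with multiplicities `ν`. -/
def sortedWord (ν : Fin 3 →₀ ℕ) : List (Fin 3) :=
  List.replicate (ν 0) 0 ++ List.replicate (ν 1) 1 ++ List.replicate (ν 2) 2

theorem coeff_coeffs (f : ℍ[ℝ] → ℍ[ℝ]) (ν : Fin 3 →₀ ℕ) :
    coeff ν (coeffs f) = (((ν 0)! * (ν 1)! * (ν 2)! : ℝ)⁻¹) •
      (((sortedWord ν).map e).foldr dirDeriv f) 0 := by
  rw [sortedWord, List.map_append, List.map_append, List.map_replicate, List.map_replicate,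
    List.map_replicate, List.foldr_append, List.foldr_append, foldr_replicate_eq_iterate,
    foldr_replicate_eq_iterate, foldr_replicate_eq_iterate]
  rfl

theorem length_sortedWord (ν : Fin 3 →₀ ℕ) : (sortedWord ν).length = ν.degree := by
  simp [sortedWord, Finsupp.degree_eq_sum, Fin.sum_univ_three, add_assoc]

theorem coeff_zero_coeffs (f : ℍ[ℝ] → ℍ[ℝ]) : coeff 0 (coeffs f) = f 0 := by
  simp [coeff_coeffs, sortedWord]

theorem factorial_add_le (a b : ℕ) : (a + b)! ≤ 2 ^ (a + b) * (a ! * b !) := by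
  rw [← Nat.add_choose_mul_factorial_mul_factorial, mul_assoc]
  gcongr
  exact Nat.choose_le_two_pow _ _

/-- The Taylor coefficients of a left-hyperholomorphic function grow at most geometrically. -/
theorem isConv_coeffs {f : ℍ[ℝ] → ℍ[ℝ]} (hf : f ∈ HypO) : IsConv (coeffs f) := by
  obtain ⟨C, r, hr, h⟩ := exists_norm_foldr_dirDeriv_le (analyticAt_of_mem_HypO hf)
  refine ⟨C, 4 * r, by positivity, fun ν => ?_⟩
  have h1 := h ((sortedWord ν).map e) (fun v hv => by
    obtain ⟨k, -, rfl⟩ := List.mem_map.1 hv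
    exact (norm_e k).le)
  rw [List.length_map, length_sortedWord] at h1
  have hC : 0 ≤ C * r ^ ν.degree := by
    have := (norm_nonneg _).trans h1
    exact nonneg_of_mul_nonneg_right this (by positivity)
  -- Division by `ν!` instead of `|ν|!` costs at most a factor `4 ^ |ν|`.
  have h2 : (ν.degree ! : ℝ) ≤ (4 ^ ν.degree * ((ν 0)! * (ν 1)! * (ν 2)!) : ℝ) := by
    have : ν.degree = ν 0 + ν 1 + ν 2 := by
      simp [Finsupp.degree_eq_sum, Fin.sum_univ_three]
    rw [this]
    norm_cast
    calc _ ≤ 2 ^ (ν 0 + ν 1 + ν 2) * ((ν 0 + ν 1)! * (ν 2)!) := factorial_add_le _ _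
      _ ≤ 2 ^ (ν 0 + ν 1 + ν 2) * ((2 ^ (ν 0 + ν 1) * ((ν 0)! * (ν 1)!)) * (ν 2)!) := by
          gcongr
          exact factorial_add_le _ _
      _ ≤ 2 ^ (ν 0 + ν 1 + ν 2) * ((2 ^ (ν 0 + ν 1 + ν 2) * ((ν 0)! * (ν 1)!)) * (ν 2)!) := by
          have : 2 ^ (ν 0 + ν 1) ≤ 2 ^ (ν 0 + ν 1 + ν 2) :=
            Nat.pow_le_pow_right (by norm_num) (Nat.le_add_right _ _)
          exact Nat.mul_le_mul_left _ (Nat.mul_le_mul_right _ (Nat.mul_le_mul_right _ this))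
      _ = _ := by
          rw [show 4 = 2 * 2 from rfl, mul_pow]
          ring
  rw [coeff_coeffs, norm_smul, Real.norm_of_nonneg (by positivity), inv_mul_le_iff₀ (by positivity)]
  calc _ ≤ _ := h1
    _ ≤ (4 ^ ν.degree * ((ν 0)! * (ν 1)! * (ν 2)!) : ℝ) * (C * r ^ ν.degree) := by gcongr
    _ = _ := by rw [mul_pow]; ring

theorem coeffs_add {f g : ℍ[ℝ] → ℍ[ℝ]} (hf : f ∈ HypO) (hg : g ∈ HypO) :
    coeffs (f + g) = coeffs f + coeffs g := by
  ext1 ν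
  rw [map_add, coeff_coeffs, coeff_coeffs, coeff_coeffs, ← smul_add,
    (foldr_dirDeriv_add (analyticAt_of_mem_HypO hf) (analyticAt_of_mem_HypO hg) _).eq_of_nhds,
    Pi.add_apply]

theorem coeffs_zero : coeffs 0 = 0 := by
  have h := coeffs_add (f := 0) (g := 0) (.of_forall fun x => ⟨differentiableAt_const _, by
    simp [cauchyFueter, pderiv]⟩) (.of_forall fun x => ⟨differentiableAt_const _, by
    simp [cauchyFueter, pderiv]⟩)
  simpa using h

theorem coeffs_neg {f : ℍ[ℝ] → ℍ[ℝ]} (hf : f ∈ HypO) : coeffs (-f) = -coeffs f := by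
  have := coeffs_add hf (neg_mem_HypO hf)
  rw [add_neg_cancel, coeffs_zero] at this
  exact (neg_eq_of_add_eq_zero_right this.symm).symm

theorem dirDeriv_mem_HypO {f : ℍ[ℝ] → ℍ[ℝ]} (hf : f ∈ HypO) (v : ℍ[ℝ]) : dirDeriv v f ∈ HypO := by
  have ha := analyticAt_of_mem_HypO hf
  have h1 : ∀ᶠ x in 𝓝 0, ∀ i, dirDeriv (basisH i) (dirDeriv v f) x =
      dirDeriv v (dirDeriv (basisH i) f) x := eventually_all.2 fun i => dirDeriv_comm ha _ _
  have h2 : cauchyFueter f =ᶠ[𝓝 0] 0 := hf.mono fun x hx => hx.2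
  have hd : ∀ᶠ x in 𝓝 0, ∀ i, DifferentiableAt ℝ (dirDeriv (basisH i) f) x :=
    eventually_all.2 fun i => differentiableAt_of_analyticAt (analyticAt_dirDeriv ha _)
  filter_upwards [differentiableAt_of_analyticAt (analyticAt_dirDeriv ha v), h1,
    dirDeriv_congr h2 v, hd] with x h3 h4 h5 h6
  refine ⟨h3, ?_⟩
  have h7 : dirDeriv v (cauchyFueter f) x =
      ∑ i, basisH i * dirDeriv v (dirDeriv (basisH i) f) x := by
    have : cauchyFueter f = fun x => ∑ i, basisH i * dirDeriv (basisH i) f x :=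
      funext fun x => cauchyFueter_eq_sum f x
    rw [this]
    have := (HasFDerivAt.fun_sum (u := Finset.univ) fun i _ =>
      ((h6 i).hasFDerivAt.const_mul (basisH i))).fderiv
    simp only [dirDeriv] at this ⊢
    rw [this]
    simp [_root_.sum_apply]
  rw [cauchyFueter_eq_sum]
  calc _ = ∑ i, basisH i * dirDeriv (basisH i) (dirDeriv v f) x := rfl
    _ = 0 := by
      simp only [h4]
      rw [← h7, h5]
      simp [dirDeriv]

/-- A left-hyperholomorphic function whose derivatives in the variables `x₁, x₂, x₃` vanish at the
origin vanishes near the origin: by the Cauchy-Fueter equation the derivatives involving `x₀`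
vanish, too. -/
theorem eventually_eq_zero_of_coeffs_eq_zero {f : ℍ[ℝ] → ℍ[ℝ]} (hf : f ∈ HypO)
    (h : coeffs f = 0) : f =ᶠ[𝓝 0] 0 := by
  have ha := analyticAt_of_mem_HypO hf
  have hword : ∀ l : List (Fin 3), ((l.map e).foldr dirDeriv f) 0 = 0 := fun l => by
    let ν : Fin 3 →₀ ℕ := Finsupp.equivFunOnFinite.symm fun k => l.count k
    have hp : l.Perm (sortedWord ν) := by
      rw [List.perm_iff_count]
      intro k
      fin_cases k <;> simp [sortedWord, ν, List.count_replicate]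
    rw [(foldr_dirDeriv_perm ha (hp.map e)).eq_of_nhds]
    have h1 := coeff_coeffs f ν
    rw [h, map_zero, eq_comm, smul_eq_zero] at h1
    refine h1.resolve_left (inv_ne_zero ?_)
    positivity
  -- The vanishing at the origin of the derivatives along all words passes from `f` to its directional
  -- derivatives, which makes an induction over all left-hyperholomorphic functions possible.
  clear h ha
  refine eventually_eq_zero_of_iterate_dirDeriv (analyticAt_of_mem_HypO hf) fun v n => ?_
  induction n generalizing f with
  | zero => exact hword []
  | succ n ih =>
    rw [Function.iterate_succ_apply]
    refine ih (dirDeriv_mem_HypO hf v) fun l => ?_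
    rw [(foldr_dirDeriv_dirDeriv (analyticAt_of_mem_HypO hf) _ v).eq_of_nhds]
    have hg : (l.map e).foldr dirDeriv f ∈ HypO := by
      clear hword
      induction l with
      | nil => exact hf
      | cons k l ihl => exact dirDeriv_mem_HypO ihl (e k)
    set g := (l.map e).foldr dirDeriv f
    have he : ∀ k, fderiv ℝ g 0 (e k) = 0 := fun k => hword (k :: l)
    have h1 : fderiv ℝ g 0 1 = 0 := by
      have := hg.self_of_nhds.2
      simpa [cauchyFueter, pderiv, he] using this
    have hv : v = v.re • (1 : ℍ[ℝ]) + v.imI • e 0 + v.imJ • e 1 + v.imK • e 2 := by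
      ext <;> simp
    rw [dirDeriv, hv]
    simp only [map_add, map_smul, he, h1, smul_zero, add_zero]

/-- A left-hyperholomorphic function is the sum of its Fueter series near the origin. -/
theorem eventuallyEq_fueterSum_coeffs {f : ℍ[ℝ] → ℍ[ℝ]} (hf : f ∈ HypO) :
    f =ᶠ[𝓝 0] fueterSum (coeffs f) := by
  have hc := isConv_coeffs hf
  have hs := hc.fueterSum_mem_HypO
  have h := eventually_eq_zero_of_coeffs_eq_zero (add_mem_HypO hf (neg_mem_HypO hs)) (by
    rw [coeffs_add hf (neg_mem_HypO hs), coeffs_neg hs, hc.coeffs_fueterSum, add_neg_cancel])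
  filter_upwards [h] with x hx
  simpa [add_neg_eq_zero] using hx

/-- Germs of left-hyperholomorphic functions are determined by their power series. -/
theorem eventuallyEq_iff_coeffs_eq {f g : ℍ[ℝ] → ℍ[ℝ]} (hf : f ∈ HypO) (hg : g ∈ HypO) :
    f =ᶠ[𝓝 0] g ↔ coeffs f = coeffs g :=
  ⟨coeffs_congr, fun h => (eventuallyEq_fueterSum_coeffs hf).trans
    (h ▸ (eventuallyEq_fueterSum_coeffs hg).symm)⟩

/-- The C-K product is well defined on germs: the product of convergent power series converges. -/
theorem ckMul_mem_HypO {f g : ℍ[ℝ] → ℍ[ℝ]} (hf : f ∈ HypO) (hg : g ∈ HypO) : ckMul f g ∈ HypO :=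
  ((isConv_coeffs hf).mul (isConv_coeffs hg)).fueterSum_mem_HypO

/-- Taking coefficients turns the C-K product into the product of power series. -/
theorem coeffs_ckMul {f g : ℍ[ℝ] → ℍ[ℝ]} (hf : f ∈ HypO) (hg : g ∈ HypO) :
    coeffs (ckMul f g) = coeffs f * coeffs g :=
  ((isConv_coeffs hf).mul (isConv_coeffs hg)).coeffs_fueterSum

end Hyperholomorphic

end

/-! ### Matrix inversion and rational power series -/

noncomputable section

namespace Hyperholomorphic

open MvPowerSeries (C X constantCoeff)

section MatrixInverse

variable {R K : Type*} [Ring R] [Ring K] [Nontrivial K] {ι : Type*} [Fintype ι] [DecidableEq ι]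

/-- Let `T` be a subring in which every element with nonzero image under `ε` has a left inverse. A
matrix over `T` whose entries lie in the kernel of `ε` then lies in the Jacobson radical of the
matrix ring over `T`, so that `1 - L` is left invertible over `T`. -/
theorem exists_matrix_left_inverse (ε : R →+* K) {T : Subring R}
    (hT : ∀ r ∈ T, ε r ≠ 0 → ∃ s ∈ T, s * r = 1) {L : Matrix ι ι R} (hL : ∀ i j, L i j ∈ T)
    (hε : ∀ i j, ε (L i j) = 0) :
    ∃ Z : Matrix ι ι R, (∀ i j, Z i j ∈ T) ∧ Z * (1 - L) = 1 := by
  let M : Matrix ι ι T := Matrix.of fun i j => ⟨L i j, hL i j⟩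
  have hM : M ∈ (⊥ : Ideal T).jacobson.matrix ι := fun i j => by
    refine Ideal.mem_jacobson_iff.2 fun y => ?_
    obtain ⟨s, hs, h1⟩ := hT (1 + y * L i j) (add_mem T.one_mem (mul_mem y.2 (hL i j)))
      (by simp [hε])
    refine ⟨⟨s, hs⟩, ?_⟩
    refine Subtype.ext ?_
    change s * (y : R) * L i j + s - 1 = 0
    rw [mul_add, mul_one, ← mul_assoc] at h1
    rw [add_comm, h1, sub_self]
  have hJ := Ideal.matrix_jacobson_le ⊥ hM
  rw [Ideal.matrix_bot, Ideal.mem_jacobson_iff] at hJ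
  obtain ⟨Z, hZ⟩ := hJ (-1)
  rw [Ideal.mem_bot] at hZ
  refine ⟨Z.map T.subtype, fun i j => (Z i j).2, ?_⟩
  have h1 : Z * (1 - M) = 1 := by
    have : Z * (1 - M) - 1 = Z * -1 * M + Z - 1 := by noncomm_ring
    rw [← sub_eq_zero, this, hZ]
  have hLM : (1 - L) = (1 - M).map T.subtype := by
    rw [Matrix.map_sub _ (map_sub T.subtype), Matrix.map_one _ (map_zero _) (map_one _)]
    rfl
  rw [hLM, ← Matrix.map_mul, h1, Matrix.map_one _ (map_zero _) (map_one _)]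

/-- In the situation of `exists_matrix_left_inverse`, `1 - L` has a two-sided inverse over `T`. -/
theorem exists_matrix_inverse (ε : R →+* K) {T : Subring R}
    (hT : ∀ r ∈ T, ε r ≠ 0 → ∃ s ∈ T, s * r = 1) {L : Matrix ι ι R} (hL : ∀ i j, L i j ∈ T)
    (hε : ∀ i j, ε (L i j) = 0) :
    ∃ Z : Matrix ι ι R, (∀ i j, Z i j ∈ T) ∧ Z * (1 - L) = 1 ∧ (1 - L) * Z = 1 := by
  obtain ⟨Z, hZ, h1⟩ := exists_matrix_left_inverse ε hT hL hε
  -- The left inverse `Z = 1 + Z L` is again of the form `1 - L'`, hence left invertible.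
  obtain ⟨U, -, hU⟩ := exists_matrix_left_inverse ε hT (L := -(Z * L))
    (fun i j => neg_mem (sum_mem fun k _ => mul_mem (hZ i k) (hL k j)))
    (fun i j => by simp [Matrix.mul_apply, hε])
  have h2 : 1 - -(Z * L) = Z := by
    have h0 : Z - Z * L = 1 := by rw [← h1, mul_sub, mul_one]
    rw [sub_neg_eq_add, ← h0, sub_add_cancel]
  rw [h2] at hU
  have h3 : U = 1 - L := by
    calc U = U * (Z * (1 - L)) := by rw [h1, mul_one]
      _ = 1 - L := by rw [← mul_assoc, hU, one_mul]
  exact ⟨Z, hZ, h1, h3 ▸ hU⟩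

end MatrixInverse

section Rational

variable {σ K : Type*} [Fintype σ] [DivisionRing K]

/-- The left `K`-space `K + ∑ₖ Xₖ V` of power series. -/
def shiftSpan (V : Submodule K (MvPowerSeries σ K)) : Submodule K (MvPowerSeries σ K) where
  carrier := {u | ∃ (a : K) (w : σ → MvPowerSeries σ K), (∀ k, w k ∈ V) ∧
    u = C a + ∑ k, X k * w k}
  add_mem' := by
    rintro _ _ ⟨a, w, hw, rfl⟩ ⟨b, z, hz, rfl⟩
    refine ⟨a + b, w + z, fun k => V.add_mem (hw k) (hz k), ?_⟩
    simp only [map_add, Pi.add_apply, mul_add, Finset.sum_add_distrib]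
    abel
  zero_mem' := ⟨0, 0, fun _ => V.zero_mem, by simp⟩
  smul_mem' := by
    rintro c _ ⟨a, w, hw, rfl⟩
    refine ⟨c * a, c • w, fun k => V.smul_mem _ (hw k), ?_⟩
    simp only [MvPowerSeries.smul_eq_C_mul, Pi.smul_apply, mul_add, map_mul, Finset.mul_sum]
    congr 1
    refine Finset.sum_congr rfl fun k _ => ?_
    rw [← mul_assoc, ← mul_assoc, MvPowerSeries.X_mul]

theorem mem_shiftSpan {V : Submodule K (MvPowerSeries σ K)} {u : MvPowerSeries σ K} :
    u ∈ shiftSpan V ↔ ∃ (a : K) (w : σ → MvPowerSeries σ K), (∀ k, w k ∈ V) ∧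
      u = C a + ∑ k, X k * w k := Iff.rfl

theorem shiftSpan_mono {V W : Submodule K (MvPowerSeries σ K)} (h : V ≤ W) :
    shiftSpan V ≤ shiftSpan W := fun _ ⟨a, w, hw, hu⟩ => ⟨a, w, fun k => h (hw k), hu⟩

theorem C_mem_shiftSpan (V : Submodule K (MvPowerSeries σ K)) (a : K) : C a ∈ shiftSpan V :=
  ⟨a, 0, fun _ => V.zero_mem, by simp⟩

theorem X_mul_mem_shiftSpan [DecidableEq σ] {V : Submodule K (MvPowerSeries σ K)} (k : σ)
    {w : MvPowerSeries σ K} (hw : w ∈ V) : X k * w ∈ shiftSpan V := by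
  refine ⟨0, Pi.single k w, fun j => ?_, ?_⟩
  · rcases eq_or_ne j k with rfl | h
    · simpa using hw
    · simp [h]
  · rw [map_zero, zero_add, Finset.sum_eq_single k]
    · simp
    · intro j _ hj
      simp [hj]
    · simp

/-- Right multiplication by a power series, as a left-linear map. -/
def mulRightL (s : MvPowerSeries σ K) : MvPowerSeries σ K →ₗ[K] MvPowerSeries σ K where
  toFun u := u * s
  map_add' u v := add_mul u v s
  map_smul' c u := by simp only [MvPowerSeries.smul_eq_C_mul, mul_assoc, RingHom.id_apply]

theorem mulRightL_apply {τ L : Type*} [DivisionRing L] (s u : MvPowerSeries τ L) :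
    mulRightL s u = u * s := rfl

/-- A power series `r` is called rational if it lies in a finitely generated left `K`-space `V` with
`V ⊆ K + ∑ₖ Xₖ V`. With respect to a generating vector `u` of `V`, the inclusion is a linear system
`u = v + (∑ₖ Xₖ Aₖ) u` with constant matrices `Aₖ` and a constant vector `v`, of which `r` is an
output `r = c u`. -/
def IsRational (r : MvPowerSeries σ K) : Prop :=
  ∃ V : Submodule K (MvPowerSeries σ K), V.FG ∧ V ≤ shiftSpan V ∧ r ∈ V

theorem IsRational.add {r s : MvPowerSeries σ K} (hr : IsRational r) (hs : IsRational s) :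
    IsRational (r + s) := by
  obtain ⟨V, hV, hVs, hrV⟩ := hr
  obtain ⟨W, hW, hWs, hsW⟩ := hs
  exact ⟨V ⊔ W, hV.sup hW, sup_le (hVs.trans (shiftSpan_mono le_sup_left))
    (hWs.trans (shiftSpan_mono le_sup_right)),
    add_mem (Submodule.mem_sup_left hrV) (Submodule.mem_sup_right hsW)⟩

theorem IsRational.neg {r : MvPowerSeries σ K} (hr : IsRational r) : IsRational (-r) := by
  obtain ⟨V, hV, hVs, hrV⟩ := hr
  exact ⟨V, hV, hVs, neg_mem hrV⟩

theorem isRational_C (a : K) : IsRational (C a : MvPowerSeries σ K) :=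
  ⟨Submodule.span K {C a}, Submodule.fg_span_singleton _,
    Submodule.span_le.2 (Set.singleton_subset_iff.2 (C_mem_shiftSpan _ a)),
    Submodule.mem_span_singleton_self _⟩

theorem isRational_X [DecidableEq σ] (k : σ) : IsRational (X k : MvPowerSeries σ K) := by
  refine ⟨Submodule.span K {X k, C 1}, Submodule.fg_span (by simp), Submodule.span_le.2 ?_,
    Submodule.subset_span (by simp)⟩
  rintro _ (rfl | rfl)
  · rw [← mul_one (X k), ← map_one C]
    exact X_mul_mem_shiftSpan k (Submodule.subset_span (by simp))
  · exact C_mem_shiftSpan _ 1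

theorem IsRational.mul {r s : MvPowerSeries σ K} (hr : IsRational r) (hs : IsRational s) :
    IsRational (r * s) := by
  obtain ⟨V, hV, hVs, hrV⟩ := hr
  obtain ⟨W, hW, hWs, hsW⟩ := hs
  refine ⟨V.map (mulRightL s) ⊔ W, (hV.map _).sup hW, sup_le ?_
    (hWs.trans (shiftSpan_mono le_sup_right)),
    Submodule.mem_sup_left (Submodule.mem_map_of_mem (f := mulRightL s) hrV)⟩
  rintro _ ⟨u, hu, rfl⟩
  obtain ⟨a, w, hw, rfl⟩ := hVs hu
  have h1 : mulRightL s (C a + ∑ k, X k * w k) = a • s + (C 0 + ∑ k, X k * (w k * s)) := by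
    simp only [mulRightL_apply, add_mul, Finset.sum_mul, mul_assoc, MvPowerSeries.smul_eq_C_mul,
      map_zero, zero_add]
  rw [h1]
  exact add_mem (Submodule.smul_mem _ _ (shiftSpan_mono le_sup_right (hWs hsW)))
    ⟨0, _, fun k => Submodule.mem_sup_left (Submodule.mem_map_of_mem (f := mulRightL s) (hw k)),
      rfl⟩

/-- The inverse of a rational power series is rational. If `r = d + ∑ₖ Xₖ rₖ` with `rₖ ∈ V` and
`r s = 1`, then `s = d⁻¹ (1 - ∑ₖ Xₖ rₖ s)`, so that `V s + K s` is the required space. -/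
theorem IsRational.of_mul_eq_one {r s : MvPowerSeries σ K} (hr : IsRational r) (h : r * s = 1) :
    IsRational s := by
  obtain ⟨V, hV, hVs, hrV⟩ := hr
  set W := V.map (mulRightL s) ⊔ Submodule.span K {s} with hW
  have hsW : s ∈ W := Submodule.mem_sup_right (Submodule.mem_span_singleton_self s)
  have hVW : ∀ w ∈ V, w * s ∈ W := fun w hw =>
    Submodule.mem_sup_left (Submodule.mem_map_of_mem (f := mulRightL s) hw)
  have hs : s ∈ shiftSpan W := by
    obtain ⟨d, w, hw, hr⟩ := hVs hrV
    have hd : d ≠ 0 := by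
      rintro rfl
      have h1 := congrArg constantCoeff h
      rw [map_mul, hr] at h1
      simp at h1
    have h1 : C d * s = C 1 - (C 0 + ∑ k, X k * (w k * s)) := by
      rw [map_one, ← h, hr]
      simp only [add_mul, Finset.sum_mul, mul_assoc, map_zero, zero_add]
      abel
    have h2 : s = d⁻¹ • (C 1 - (C 0 + ∑ k, X k * (w k * s))) := by
      rw [← h1, MvPowerSeries.smul_eq_C_mul, ← mul_assoc, ← map_mul, inv_mul_cancel₀ hd, map_one,
        one_mul]
    rw [h2]
    exact Submodule.smul_mem _ _ (sub_mem (C_mem_shiftSpan W 1) ⟨0, _, fun k => hVW _ (hw k), rfl⟩)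
  refine ⟨W, (hV.map _).sup (Submodule.fg_span_singleton s), sup_le ?_
    (Submodule.span_le.2 (Set.singleton_subset_iff.2 hs)), hsW⟩
  rintro _ ⟨u, hu, rfl⟩
  obtain ⟨a, w, hw, rfl⟩ := hVs hu
  have h1 : mulRightL s (C a + ∑ k, X k * w k) = a • s + (C 0 + ∑ k, X k * (w k * s)) := by
    simp only [mulRightL_apply, add_mul, Finset.sum_mul, mul_assoc, MvPowerSeries.smul_eq_C_mul,
      map_zero, zero_add]
  rw [h1]
  exact add_mem (Submodule.smul_mem _ _ hs) ⟨0, _, fun k => hVW _ (hw k), rfl⟩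

theorem isRational_monomial (ν : Fin 3 →₀ ℕ) (a : K) : IsRational (MvPowerSeries.monomial ν a) := by
  have hX : ∀ (k : Fin 3) (n : ℕ), IsRational (X k ^ n : MvPowerSeries (Fin 3) K) := fun k n => by
    induction n with
    | zero => rw [pow_zero, ← map_one C]; exact isRational_C 1
    | succ n ih => rw [pow_succ]; exact ih.mul (isRational_X k)
  have h : MvPowerSeries.monomial ν a = C a * (X 0 ^ ν 0 * X 1 ^ ν 1 * X 2 ^ ν 2) := by
    rw [← MvPowerSeries.monomial_zero_eq_C_apply, MvPowerSeries.X_pow_eq, MvPowerSeries.X_pow_eq,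
      MvPowerSeries.X_pow_eq, MvPowerSeries.monomial_mul_monomial,
      MvPowerSeries.monomial_mul_monomial, MvPowerSeries.monomial_mul_monomial]
    congr 1
    · congr 1
      ext k
      fin_cases k <;> simp
    · simp
  rw [h]
  exact (isRational_C a).mul (((hX _ _).mul (hX _ _)).mul (hX _ _))

/-- Finitely many rational power series are outputs of one common linear system. -/
theorem exists_common_linear_system {ι : Type*} [Finite ι] {r : ι → MvPowerSeries σ K}
    (hr : ∀ i, IsRational (r i)) :
    ∃ (ℓ : ℕ) (u : Fin ℓ → MvPowerSeries σ K) (A : σ → Matrix (Fin ℓ) (Fin ℓ) K) (v : Fin ℓ → K)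
      (c : ι → Fin ℓ → K), (∀ a, u a = C (v a) + ∑ b, (∑ k, X k * C (A k a b)) * u b) ∧
        ∀ i, r i = ∑ a, C (c i a) * u a := by
  choose V hV hVs hrV using hr
  have hFG : (⨆ i, V i).FG := Submodule.fg_iSup V hV
  have hshift : (⨆ i, V i) ≤ shiftSpan (⨆ i, V i) :=
    iSup_le fun i => (hVs i).trans (shiftSpan_mono (le_iSup V i))
  have hmem : ∀ i, r i ∈ ⨆ i, V i := fun i => Submodule.mem_iSup_of_mem i (hrV i)
  obtain ⟨ℓ, u, hu⟩ := Submodule.fg_iff_exists_fin_generating_family.1 hFG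
  rw [← hu] at hshift hmem
  have hspan : ∀ w ∈ Submodule.span K (Set.range u), ∃ c : Fin ℓ → K, ∑ a, C (c a) * u a = w :=
    fun w hw => by
      obtain ⟨c, hc⟩ := (Submodule.mem_span_range_iff_exists_fun K).1 hw
      exact ⟨c, by simpa only [MvPowerSeries.smul_eq_C_mul] using hc⟩
  have hu' : ∀ a, u a ∈ shiftSpan (Submodule.span K (Set.range u)) := fun a =>
    hshift (Submodule.subset_span ⟨a, rfl⟩)
  choose v w hw huw using fun a => mem_shiftSpan.1 (hu' a)
  choose A hA using fun a k => hspan (w a k) (hw a k)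
  choose c hc using fun i => hspan (r i) (hmem i)
  refine ⟨ℓ, u, fun k => Matrix.of fun a b => A a k b, v, c, fun a => ?_, fun i => (hc i).symm⟩
  conv_lhs => rw [huw a]
  congr 1
  simp only [Matrix.of_apply, Finset.sum_mul]
  rw [Finset.sum_comm]
  refine Finset.sum_congr rfl fun k _ => ?_
  rw [← hA, Finset.mul_sum]
  simp only [mul_assoc]

end Rational

end Hyperholomorphic

end

/-! ### Polynomials have rational power series -/

noncomputable section

namespace Hyperholomorphic

open Filter
open Finsupp (single)
open MvPowerSeries (coeff)

theorem hasFDerivAt_mvPolynomial_eval {σ : Type*} [Fintype σ] (p : MvPolynomial σ ℝ) (y : σ → ℝ) :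
    HasFDerivAt (fun y => MvPolynomial.eval y p)
      (∑ i, MvPolynomial.eval y (MvPolynomial.pderiv i p) •
        (ContinuousLinearMap.proj i : (σ → ℝ) →L[ℝ] ℝ)) y := by
  classical
  induction p using MvPolynomial.induction_on with
  | C a => simpa using hasFDerivAt_const _ _
  | add p q hp hq =>
    simp only [map_add, add_smul, Finset.sum_add_distrib]
    exact hp.add hq
  | mul_X p j hp =>
    simp only [map_mul, MvPolynomial.eval_X]
    refine (hp.mul (hasFDerivAt_apply (𝕜 := ℝ) (F' := fun _ : σ => ℝ) j y)).congr_fderiv ?_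
    ext v
    simp [MvPolynomial.pderiv_X, Pi.single_apply, Finset.mul_sum, Finset.sum_add_distrib,
      add_smul, apply_ite]
    simp only [mul_assoc]

theorem coords_eq (x : ℍ[ℝ]) : ![x.re, x.imI, x.imJ, x.imK] = ofCoords.symm x := by
  rw [ContinuousLinearEquiv.eq_symm_apply]
  ext <;> simp

theorem isPolynomial_iff {f : ℍ[ℝ] → ℍ[ℝ]} : IsPolynomial f ↔
    ∃ p : Fin 4 → MvPolynomial (Fin 4) ℝ,
      ∀ x, f x = ofCoords fun i => MvPolynomial.eval (ofCoords.symm x) (p i) := by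
  simp only [IsPolynomial, coords_eq]
  rfl

theorem dirDeriv_polynomial (p : Fin 4 → MvPolynomial (Fin 4) ℝ) (j : Fin 4) :
    dirDeriv (basisH j) (fun x : ℍ[ℝ] =>
        ofCoords fun i => MvPolynomial.eval (ofCoords.symm x) (p i)) =
      fun x => ofCoords fun i =>
        MvPolynomial.eval (ofCoords.symm x) (MvPolynomial.pderiv j (p i)) := by
  funext x
  have h := (ofCoords.hasFDerivAt.comp x ((hasFDerivAt_pi.2 fun i =>
    hasFDerivAt_mvPolynomial_eval (p i) (ofCoords.symm x)).comp x
      (ofCoords.symm.hasFDerivAt (x := x)))).fderiv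
  have h' := congrArg (fun L : ℍ[ℝ] →L[ℝ] ℍ[ℝ] => L (basisH j)) h
  refine h'.trans ?_
  have hs : ofCoords.symm (basisH j) = Pi.single j 1 := by
    rw [← ofCoords_single, ContinuousLinearEquiv.symm_apply_apply]
  simp [hs, Pi.single_apply, _root_.sum_apply]

theorem foldr_dirDeriv_polynomial (p : Fin 4 → MvPolynomial (Fin 4) ℝ) (l : List (Fin 4)) :
    (l.map basisH).foldr dirDeriv (fun x : ℍ[ℝ] =>
        ofCoords fun i => MvPolynomial.eval (ofCoords.symm x) (p i)) =
      fun x => ofCoords fun i => MvPolynomial.eval (ofCoords.symm x)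
        (l.foldr (fun j q => MvPolynomial.pderiv j q) (p i)) := by
  induction l with
  | nil => rfl
  | cons j l ih => rw [List.map_cons, List.foldr_cons, ih, dirDeriv_polynomial]; rfl

theorem exists_coeff_ne_zero_of_foldr_pderiv {σ : Type*} (p : MvPolynomial σ ℝ) (l : List σ)
    (m : σ →₀ ℕ) (h : (l.foldr (fun j q => MvPolynomial.pderiv j q) p).coeff m ≠ 0) :
    ∃ m', p.coeff m' ≠ 0 ∧ m'.degree = m.degree + l.length := by
  induction l generalizing m with
  | nil => exact ⟨m, h, rfl⟩
  | cons j l ih =>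
    rw [List.foldr_cons, MvPolynomial.coeff_pderiv] at h
    obtain ⟨m', h1, h2⟩ := ih (m + single j 1) (left_ne_zero_of_mul h)
    refine ⟨m', h1, ?_⟩
    rw [h2, map_add, Finsupp.degree_single, List.length_cons]
    ring

theorem foldr_pderiv_eq_zero {σ : Type*} (p : MvPolynomial σ ℝ) (l : List σ)
    (h : p.totalDegree < l.length) : l.foldr (fun j q => MvPolynomial.pderiv j q) p = 0 := by
  ext m
  by_contra hm
  obtain ⟨m', h1, h2⟩ := exists_coeff_ne_zero_of_foldr_pderiv p l m (by simpa using hm)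
  have h3 := MvPolynomial.le_totalDegree (MvPolynomial.mem_support_iff.2 h1)
  change m'.degree ≤ _ at h3
  omega

theorem isRational_sum {ι : Type*} (s : Finset ι) (r : ι → MvPowerSeries (Fin 3) ℍ[ℝ])
    (h : ∀ i ∈ s, IsRational (r i)) : IsRational (∑ i ∈ s, r i) :=
  Finset.sum_induction _ _ (fun _ _ => IsRational.add)
    (by simpa using isRational_C (σ := Fin 3) (0 : ℍ[ℝ])) h

/-- The coefficients of a polynomial form a rational power series, because only finitely many of
them are nonzero. -/
theorem isRational_coeffs_of_isPolynomial {f : ℍ[ℝ] → ℍ[ℝ]} (hf : IsPolynomial f) :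
    IsRational (coeffs f) := by
  obtain ⟨p, hp⟩ := isPolynomial_iff.1 hf
  have hfp := funext hp
  set N := ∑ i, (p i).totalDegree
  have hzero : ∀ ν : Fin 3 →₀ ℕ, N < ν.degree → coeff ν (coeffs f) = 0 := fun ν hν => by
    have he : (sortedWord ν).map e = ((sortedWord ν).map Fin.succ).map basisH := by
      rw [List.map_map]
      refine List.map_congr_left fun k _ => ?_
      fin_cases k <;> rfl
    rw [coeff_coeffs, hfp, he, foldr_dirDeriv_polynomial]
    have h0 : ∀ i, ((sortedWord ν).map Fin.succ).foldr (fun j q => MvPolynomial.pderiv j q) (p i) =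
        0 := fun i => foldr_pderiv_eq_zero _ _ (by
      rw [List.length_map, length_sortedWord]
      exact (Finset.single_le_sum (f := fun i => (p i).totalDegree) (fun _ _ => Nat.zero_le _)
        (Finset.mem_univ i)).trans_lt hν)
    simp only [h0, map_zero]
    rw [show (fun _ : Fin 4 => (0 : ℝ)) = 0 from rfl, map_zero ofCoords, smul_zero]
  let s : Finset (Fin 3 →₀ ℕ) := Finset.Iic (Finsupp.equivFunOnFinite.symm fun _ => N)
  have hsum : coeffs f = ∑ ν ∈ s, MvPowerSeries.monomial ν (coeff ν (coeffs f)) := by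
    ext1 μ
    simp only [map_sum, MvPowerSeries.coeff_monomial]
    rw [Finset.sum_ite_eq]
    split_ifs with hμ
    · rfl
    · refine hzero μ (not_le.1 fun hle => hμ ?_)
      simp only [s, Finset.mem_Iic]
      exact fun k => (Finsupp.le_degree k μ).trans hle
  rw [hsum]
  exact isRational_sum _ _ fun ν _ => isRational_monomial ν _

end Hyperholomorphic

end

/-! ### Realizations -/

noncomputable section

namespace Hyperholomorphic

open Filter
open Finsupp (single)
open MvPowerSeries (coeff C X constantCoeff)

theorem fueterSum_monomial (ν : Fin 3 →₀ ℕ) (a : ℍ[ℝ]) :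
    fueterSum (MvPowerSeries.monomial ν a) = fun x => fueter ν x * a := by
  funext x
  rw [fueterSum, tsum_eq_single ν]
  · rw [MvPowerSeries.coeff_monomial_same]
  · intro μ hμ
    rw [MvPowerSeries.coeff_monomial_ne hμ, mul_zero]

theorem fueter_single (k : Fin 3) (x : ℍ[ℝ]) : fueter (single k 1) x = zeta k x := by
  have h := coeff_zetaSeries_mul x (single k 1) 1
  rw [mul_one, Finset.sum_eq_single k] at h
  · have h2 : ∏ j : Fin 3, ((single k 1 : Fin 3 →₀ ℕ) j)! = 1 :=
      Finset.prod_eq_one fun j _ => by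
        rw [Finsupp.single_apply]
        split_ifs <;> rfl
    rw [fueter_eq_coeff, Finsupp.degree_single, pow_one, h, h2]
    simp
  · intro j _ hj
    rw [if_neg]
    rw [Finsupp.single_le_iff, Finsupp.single_apply, if_neg (Ne.symm hj)]
    omega
  · simp

theorem fun_const_mem_HypO (a : ℍ[ℝ]) : (fun _ => a) ∈ HypO := by
  have h := (isConv_monomial 0 a).fueterSum_mem_HypO
  simpa only [fueterSum_monomial, fueter_zero, one_mul] using h

theorem coeffs_fun_const (a : ℍ[ℝ]) : coeffs (fun _ => a) = C a := by
  have h := (isConv_monomial 0 a).coeffs_fueterSum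
  simp only [fueterSum_monomial, fueter_zero, one_mul] at h
  rw [h, MvPowerSeries.monomial_zero_eq_C_apply]

theorem X_mul_C (k : Fin 3) (a : ℍ[ℝ]) : X k * C a = MvPowerSeries.monomial (single k 1) a := by
  rw [MvPowerSeries.X_def, ← MvPowerSeries.monomial_zero_eq_C_apply,
    MvPowerSeries.monomial_mul_monomial, one_mul, add_zero]

theorem zeta_mul_mem_HypO (k : Fin 3) (a : ℍ[ℝ]) : (fun x => zeta k x * a) ∈ HypO := by
  have h := (isConv_monomial (single k 1) a).fueterSum_mem_HypO
  simpa only [fueterSum_monomial, fueter_single] using h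

theorem coeffs_zeta_mul (k : Fin 3) (a : ℍ[ℝ]) : coeffs (fun x => zeta k x * a) = X k * C a := by
  have h := (isConv_monomial (single k 1) a).coeffs_fueterSum
  rw [X_mul_C]
  simpa only [fueterSum_monomial, fueter_single] using h

theorem sum_mem_HypO_and_coeffs {ι : Type*} (s : Finset ι) {f : ι → ℍ[ℝ] → ℍ[ℝ]}
    (hf : ∀ i ∈ s, f i ∈ HypO) :
    ∑ i ∈ s, f i ∈ HypO ∧ coeffs (∑ i ∈ s, f i) = ∑ i ∈ s, coeffs (f i) := by
  classical
  induction s using Finset.induction_on with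
  | empty => exact ⟨fun_const_mem_HypO 0, coeffs_zero⟩
  | insert i s hi ih =>
    obtain ⟨h1, h2⟩ := ih fun j hj => hf j (Finset.mem_insert_of_mem hj)
    have h3 := hf i (Finset.mem_insert_self i s)
    rw [Finset.sum_insert hi, Finset.sum_insert hi, coeffs_add h3 h1, h2]
    exact ⟨add_mem_HypO h3 h1, rfl⟩

variable {m n p : ℕ}

/-- The matrix of power series that belongs to a matrix of functions. -/
def coeffsMat (F : MatFun m n) : Matrix (Fin m) (Fin n) (MvPowerSeries (Fin 3) ℍ[ℝ]) :=
  F.map coeffs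

/-- Matrices of germs are determined by their matrices of power series. -/
theorem germEq_iff {F G : MatFun m n} (hF : IsHyp F) (hG : IsHyp G) :
    GermEq F G ↔ coeffsMat F = coeffsMat G := by
  rw [← Matrix.ext_iff]
  exact forall_congr' fun i => forall_congr' fun j => eventuallyEq_iff_coeffs_eq (hF i j) (hG i j)

theorem isHyp_add {F G : MatFun m n} (hF : IsHyp F) (hG : IsHyp G) : IsHyp (F + G) :=
  fun i j => add_mem_HypO (hF i j) (hG i j)

theorem coeffsMat_add {F G : MatFun m n} (hF : IsHyp F) (hG : IsHyp G) :
    coeffsMat (F + G) = coeffsMat F + coeffsMat G :=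
  Matrix.ext fun i j => coeffs_add (hF i j) (hG i j)

theorem isHyp_sub {F G : MatFun m n} (hF : IsHyp F) (hG : IsHyp G) : IsHyp (F - G) :=
  fun i j => by
    rw [Matrix.sub_apply, sub_eq_add_neg]
    exact add_mem_HypO (hF i j) (neg_mem_HypO (hG i j))

theorem coeffsMat_sub {F G : MatFun m n} (hF : IsHyp F) (hG : IsHyp G) :
    coeffsMat (F - G) = coeffsMat F - coeffsMat G :=
  Matrix.ext fun i j => by
    simp only [coeffsMat, Matrix.map_apply, Matrix.sub_apply]
    rw [sub_eq_add_neg, coeffs_add (hF i j) (neg_mem_HypO (hG i j)), coeffs_neg (hG i j),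
      sub_eq_add_neg]

theorem isHyp_ckMatMul {F : MatFun m n} {G : MatFun n p} (hF : IsHyp F) (hG : IsHyp G) :
    IsHyp (ckMatMul F G) := fun i k =>
  (sum_mem_HypO_and_coeffs Finset.univ fun j _ => ckMul_mem_HypO (hF i j) (hG j k)).1

theorem coeffsMat_ckMatMul {F : MatFun m n} {G : MatFun n p} (hF : IsHyp F) (hG : IsHyp G) :
    coeffsMat (ckMatMul F G) = coeffsMat F * coeffsMat G :=
  Matrix.ext fun i k => by
    have h := (sum_mem_HypO_and_coeffs Finset.univ fun j _ =>
      ckMul_mem_HypO (hF i j) (hG j k)).2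
    simp only [coeffs_ckMul (hF i _) (hG _ k)] at h
    simpa only [coeffsMat, Matrix.map_apply, ckMatMul, Matrix.of_apply, Matrix.mul_apply] using h

theorem isHyp_constMat (D : Matrix (Fin m) (Fin n) ℍ[ℝ]) : IsHyp (constMat D) :=
  fun i j => fun_const_mem_HypO (D i j)

theorem coeffsMat_constMat (D : Matrix (Fin m) (Fin n) ℍ[ℝ]) : coeffsMat (constMat D) = D.map C :=
  Matrix.ext fun i j => coeffs_fun_const (D i j)

/-- The matrix `X₁ A₁ + X₂ A₂ + X₃ A₃` of power series. -/
def linMat {ι κ : Type*} (A : Fin 3 → Matrix ι κ ℍ[ℝ]) :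
    Matrix ι κ (MvPowerSeries (Fin 3) ℍ[ℝ]) :=
  Matrix.of fun i j => ∑ k, X k * C (A k i j)

theorem linMat_mem {ι κ : Type*} {T : Subring (MvPowerSeries (Fin 3) ℍ[ℝ])}
    (hT : ∀ k a, X k * C a ∈ T) (A : Fin 3 → Matrix ι κ ℍ[ℝ]) (i : ι) (j : κ) : linMat A i j ∈ T := by
  rw [linMat, Matrix.of_apply]
  exact sum_mem fun k _ => hT k _

theorem zetaMat_apply (A : Fin 3 → Matrix (Fin m) (Fin n) ℍ[ℝ]) (i : Fin m) (j : Fin n) :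
    zetaMat A i j = ∑ k, fun x => zeta k x * A k i j := by
  funext x
  simp [zetaMat]

theorem isHyp_zetaMat (A : Fin 3 → Matrix (Fin m) (Fin n) ℍ[ℝ]) : IsHyp (zetaMat A) :=
  fun i j => by
    rw [zetaMat_apply]
    exact (sum_mem_HypO_and_coeffs Finset.univ fun k _ => zeta_mul_mem_HypO k (A k i j)).1

theorem coeffsMat_zetaMat (A : Fin 3 → Matrix (Fin m) (Fin n) ℍ[ℝ]) :
    coeffsMat (zetaMat A) = linMat A :=
  Matrix.ext fun i j => by
    rw [coeffsMat, Matrix.map_apply, zetaMat_apply,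
      (sum_mem_HypO_and_coeffs Finset.univ fun k _ => zeta_mul_mem_HypO k (A k i j)).2]
    simp only [coeffs_zeta_mul]
    rfl

theorem constantCoeff_linMat {ι κ : Type*} (A : Fin 3 → Matrix ι κ ℍ[ℝ]) (i : ι) (j : κ) :
    constantCoeff (linMat A i j) = 0 := by
  simp [linMat]

theorem coeffsMat_one_sub_zetaMat (A : Fin 3 → Matrix (Fin n) (Fin n) ℍ[ℝ]) :
    coeffsMat (constMat 1 - zetaMat A) = 1 - linMat A := by
  rw [coeffsMat_sub (isHyp_constMat 1) (isHyp_zetaMat A), coeffsMat_constMat, coeffsMat_zetaMat,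
    Matrix.map_one _ (map_zero _) (map_one _)]

theorem isHyp_one_sub_zetaMat (A : Fin 3 → Matrix (Fin n) (Fin n) ℍ[ℝ]) :
    IsHyp (constMat 1 - zetaMat A) := isHyp_sub (isHyp_constMat 1) (isHyp_zetaMat A)

/-- For matrices over the ring of germs, `W` is the inverse of `1 - ζA` exactly if this holds for
the corresponding matrices of power series. -/
theorem isCKInverse_iff (A : Fin 3 → Matrix (Fin n) (Fin n) ℍ[ℝ]) (W : MatFun n n) :
    IsCKInverse (constMat 1 - zetaMat A) W ↔
      IsHyp W ∧ (1 - linMat A) * coeffsMat W = 1 ∧ coeffsMat W * (1 - linMat A) = 1 := by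
  have h1 := isHyp_one_sub_zetaMat A
  have hone : coeffsMat (constMat (1 : Matrix (Fin n) (Fin n) ℍ[ℝ])) = 1 := by
    rw [coeffsMat_constMat, Matrix.map_one _ (map_zero _) (map_one _)]
  constructor
  · rintro ⟨-, hW, h2, h3⟩
    rw [germEq_iff (isHyp_ckMatMul h1 hW) (isHyp_constMat 1), coeffsMat_ckMatMul h1 hW,
      coeffsMat_one_sub_zetaMat, hone] at h2
    rw [germEq_iff (isHyp_ckMatMul hW h1) (isHyp_constMat 1), coeffsMat_ckMatMul hW h1,
      coeffsMat_one_sub_zetaMat, hone] at h3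
    exact ⟨hW, h2, h3⟩
  · rintro ⟨hW, h2, h3⟩
    refine ⟨h1, hW, ?_, ?_⟩
    · rwa [germEq_iff (isHyp_ckMatMul h1 hW) (isHyp_constMat 1), coeffsMat_ckMatMul h1 hW,
        coeffsMat_one_sub_zetaMat, hone]
    · rwa [germEq_iff (isHyp_ckMatMul hW h1) (isHyp_constMat 1), coeffsMat_ckMatMul hW h1,
        coeffsMat_one_sub_zetaMat, hone]

theorem germEq_realization_iff {R : MatFun m n} (hR : IsHyp R) {ℓ : ℕ}
    (B : Fin 3 → Matrix (Fin ℓ) (Fin n) ℍ[ℝ]) (Cm : Matrix (Fin m) (Fin ℓ) ℍ[ℝ])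
    (D : Matrix (Fin m) (Fin n) ℍ[ℝ]) {W : MatFun ℓ ℓ} (hW : IsHyp W) :
    GermEq R (constMat D + ckMatMul (ckMatMul (constMat Cm) W) (zetaMat B)) ↔
      coeffsMat R = (D.map C : Matrix _ _ (MvPowerSeries (Fin 3) ℍ[ℝ])) +
        (Cm.map C : Matrix _ _ (MvPowerSeries (Fin 3) ℍ[ℝ])) * coeffsMat W * linMat B := by
  have h1 := isHyp_ckMatMul (isHyp_constMat Cm) hW
  have h2 := isHyp_ckMatMul h1 (isHyp_zetaMat B)
  rw [germEq_iff hR (isHyp_add (isHyp_constMat D) h2), coeffsMat_add (isHyp_constMat D) h2,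
    coeffsMat_ckMatMul h1 (isHyp_zetaMat B), coeffsMat_ckMatMul (isHyp_constMat Cm) hW,
    coeffsMat_constMat, coeffsMat_constMat, coeffsMat_zetaMat]

/-- The ring of convergent power series. -/
def convSubring : Subring (MvPowerSeries (Fin 3) ℍ[ℝ]) where
  carrier := {c | IsConv c}
  mul_mem' := IsConv.mul
  one_mem' := isConv_monomial 0 1
  add_mem' := IsConv.add
  zero_mem' := by
    have := isConv_monomial 0 0
    rwa [map_zero] at this
  neg_mem' := IsConv.neg

theorem exists_mul_eq_one_of_constantCoeff_ne_zero {r : MvPowerSeries (Fin 3) ℍ[ℝ]}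
    (hr : constantCoeff r ≠ 0) : ∃ s, r * s = 1 ∧ s * r = 1 :=
  ⟨r.invOfUnit (Units.mk0 _ hr), MvPowerSeries.mul_invOfUnit r _ rfl,
    MvPowerSeries.invOfUnit_mul r _ rfl⟩

/-- The matrix `1 - ζA` has a C-K inverse. -/
theorem exists_isCKInverse (A : Fin 3 → Matrix (Fin n) (Fin n) ℍ[ℝ]) :
    ∃ W : MatFun n n, IsCKInverse (constMat 1 - zetaMat A) W := by
  have hL : ∀ i j, linMat A i j ∈ convSubring := linMat_mem (fun k a => by
    rw [X_mul_C]
    exact isConv_monomial _ _) A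
  obtain ⟨Z, hZ, h1, h2⟩ := exists_matrix_inverse (constantCoeff (σ := Fin 3) (R := ℍ[ℝ]))
    (T := convSubring) (fun r hr h => by
      obtain ⟨s, h1, h2⟩ := exists_mul_eq_one_of_constantCoeff_ne_zero h
      exact ⟨s, IsConv.of_mul_eq_one hr h1, h2⟩) hL (constantCoeff_linMat A)
  have hW : coeffsMat (Matrix.of fun i j => fueterSum (Z i j)) = Z :=
    Matrix.ext fun i j => (hZ i j).coeffs_fueterSum
  refine ⟨_, (isCKInverse_iff A (Matrix.of fun i j => fueterSum (Z i j))).2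
    ⟨fun i j => (hZ i j).fueterSum_mem_HypO, ?_, ?_⟩⟩
  · rw [hW, h2]
  · rw [hW, h1]

theorem isPolynomial_const (a : ℍ[ℝ]) : IsPolynomial fun _ => a :=
  ⟨![.C a.re, .C a.imI, .C a.imJ, .C a.imK], fun x => by ext <;> simp⟩

theorem isPolynomial_zeta (k : Fin 3) : IsPolynomial (zeta k) :=
  ⟨![.X k.succ, -.C (e k).imI * .X 0, -.C (e k).imJ * .X 0, -.C (e k).imK * .X 0], fun x => by
    ext <;> fin_cases k <;> simp [zeta]⟩

theorem zeta_mem_HypO (k : Fin 3) : zeta k ∈ HypO := by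
  simpa using zeta_mul_mem_HypO k 1

theorem coeffs_zeta (k : Fin 3) : coeffs (zeta k) = X k := by
  simpa using coeffs_zeta_mul k 1

/-- The power series of the elements of an inversion-closed subring. -/
def IsInversionClosedSubring.subring {S : Set (ℍ[ℝ] → ℍ[ℝ])} (hS : IsInversionClosedSubring S) :
    Subring (MvPowerSeries (Fin 3) ℍ[ℝ]) where
  carrier := coeffs '' S
  mul_mem' := by
    rintro _ _ ⟨f, hf, rfl⟩ ⟨g, hg, rfl⟩
    exact ⟨_, hS.mul f hf g hg, coeffs_ckMul (hS.subset hf) (hS.subset hg)⟩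
  one_mem' := ⟨_, hS.poly _ (fun_const_mem_HypO 1) (isPolynomial_const 1), by
    rw [coeffs_fun_const, map_one]⟩
  add_mem' := by
    rintro _ _ ⟨f, hf, rfl⟩ ⟨g, hg, rfl⟩
    exact ⟨_, hS.add f hf g hg, coeffs_add (hS.subset hf) (hS.subset hg)⟩
  zero_mem' := ⟨_, hS.poly _ (fun_const_mem_HypO 0) (isPolynomial_const 0), by
    rw [coeffs_fun_const, map_zero]⟩
  neg_mem' := by
    rintro _ ⟨f, hf, rfl⟩
    exact ⟨_, hS.neg f hf, coeffs_neg (hS.subset hf)⟩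

theorem IsInversionClosedSubring.mem_of_coeffs_mem {S : Set (ℍ[ℝ] → ℍ[ℝ])}
    (hS : IsInversionClosedSubring S) {f : ℍ[ℝ] → ℍ[ℝ]} (hf : f ∈ HypO)
    (h : coeffs f ∈ hS.subring) : f ∈ S := by
  obtain ⟨g, hg, hgf⟩ := h
  exact hS.congr g hg f ((eventuallyEq_iff_coeffs_eq (hS.subset hg) hf).2 hgf)

theorem IsInversionClosedSubring.C_mem {S : Set (ℍ[ℝ] → ℍ[ℝ])}
    (hS : IsInversionClosedSubring S) (a : ℍ[ℝ]) : C a ∈ hS.subring :=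
  ⟨_, hS.poly _ (fun_const_mem_HypO a) (isPolynomial_const a), coeffs_fun_const a⟩

theorem IsInversionClosedSubring.X_mem {S : Set (ℍ[ℝ] → ℍ[ℝ])}
    (hS : IsInversionClosedSubring S) (k : Fin 3) : X k ∈ hS.subring :=
  ⟨_, hS.poly _ (zeta_mem_HypO k) (isPolynomial_zeta k), coeffs_zeta k⟩

theorem IsInversionClosedSubring.exists_left_inverse {S : Set (ℍ[ℝ] → ℍ[ℝ])}
    (hS : IsInversionClosedSubring S) (r : MvPowerSeries (Fin 3) ℍ[ℝ]) (hr : r ∈ hS.subring)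
    (h0 : constantCoeff r ≠ 0) : ∃ s ∈ hS.subring, s * r = 1 := by
  obtain ⟨f, hf, rfl⟩ := hr
  rw [← MvPowerSeries.coeff_zero_eq_constantCoeff_apply, coeff_zero_coeffs] at h0
  obtain ⟨g, hg, -, h⟩ := hS.inv f hf h0
  refine ⟨coeffs g, ⟨g, hg, rfl⟩, ?_⟩
  rw [← coeffs_ckMul (hS.subset hg) (hS.subset hf), coeffs_congr h, coeffs_fun_const, map_one]

/-- The entries of a realizable function lie in every inversion-closed subring: the matrix `1 - ζA`
is invertible over such a ring, and inverses are unique. -/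
theorem mem_RatQ_of_hasRealization {R : MatFun m n} (hR : IsHyp R) (h : HasRealization R)
    (i : Fin m) (j : Fin n) : R i j ∈ RatQ := by
  intro S hS
  obtain ⟨ℓ, A, B, Cm, D, W, hW, hRW⟩ := h
  obtain ⟨hWh, hW1, hW2⟩ := (isCKInverse_iff A W).1 hW
  rw [germEq_realization_iff hR B Cm D hWh] at hRW
  have hlin : ∀ {p q : ℕ} (A : Fin 3 → Matrix (Fin p) (Fin q) ℍ[ℝ]) i j,
      linMat A i j ∈ hS.subring := fun A =>
    linMat_mem (fun k a => mul_mem (hS.X_mem k) (hS.C_mem a)) A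
  obtain ⟨Z, hZ, h1, -⟩ := exists_matrix_inverse (constantCoeff (σ := Fin 3) (R := ℍ[ℝ]))
    hS.exists_left_inverse (hlin A) (constantCoeff_linMat A)
  have hZW : Z = coeffsMat W := by
    calc Z = Z * ((1 - linMat A) * coeffsMat W) := by rw [hW1, Matrix.mul_one]
      _ = coeffsMat W := by rw [← Matrix.mul_assoc, h1, Matrix.one_mul]
  refine hS.mem_of_coeffs_mem (hR i j) ?_
  have hij : coeffs (R i j) = coeffsMat R i j := rfl
  rw [hij, hRW, ← hZW, Matrix.add_apply, Matrix.mul_apply]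
  simp only [Matrix.mul_apply]
  refine add_mem (hS.C_mem _) (sum_mem fun b _ => mul_mem (sum_mem fun a _ => ?_) (hlin B _ _))
  exact mul_mem (hS.C_mem _) (hZ _ _)

/-- The functions with rational power series form an inversion-closed subring. -/
theorem isInversionClosedSubring_isRational :
    IsInversionClosedSubring {f | f ∈ HypO ∧ IsRational (coeffs f)} where
  subset _ hf := hf.1
  congr f hf g h := ⟨mem_HypO_congr hf.1 h, coeffs_congr h ▸ hf.2⟩
  add f hf g hg := ⟨add_mem_HypO hf.1 hg.1, by
    rw [coeffs_add hf.1 hg.1]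
    exact hf.2.add hg.2⟩
  neg f hf := ⟨neg_mem_HypO hf.1, by
    rw [coeffs_neg hf.1]
    exact hf.2.neg⟩
  mul f hf g hg := ⟨ckMul_mem_HypO hf.1 hg.1, by
    rw [coeffs_ckMul hf.1 hg.1]
    exact hf.2.mul hg.2⟩
  poly f hf hp := ⟨hf, isRational_coeffs_of_isPolynomial hp⟩
  inv f hf h0 := by
    rw [← coeff_zero_coeffs f, MvPowerSeries.coeff_zero_eq_constantCoeff_apply] at h0
    obtain ⟨s, h1, h2⟩ := exists_mul_eq_one_of_constantCoeff_ne_zero h0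
    have hs := (isConv_coeffs hf.1).of_mul_eq_one h1
    have hsH := hs.fueterSum_mem_HypO
    have hone : coeffs (fun _ => (1 : ℍ[ℝ])) = 1 := by rw [coeffs_fun_const, map_one]
    refine ⟨fueterSum s, ⟨hsH, ?_⟩, ?_, ?_⟩
    · rw [hs.coeffs_fueterSum]
      exact hf.2.of_mul_eq_one h1
    · rw [eventuallyEq_iff_coeffs_eq (ckMul_mem_HypO hf.1 hsH) (fun_const_mem_HypO 1),
        coeffs_ckMul hf.1 hsH, hs.coeffs_fueterSum, h1, hone]
    · rw [eventuallyEq_iff_coeffs_eq (ckMul_mem_HypO hsH hf.1) (fun_const_mem_HypO 1),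
        coeffs_ckMul hsH hf.1, hs.coeffs_fueterSum, h2, hone]

/-- If all entries are rational, they are outputs of one linear system with state vector
`u = v + (∑ₖ Xₖ Aₖ) u`. The state of the realization consists of one copy of `u - v` for each
column, and `u - v = (1 - ∑ₖ Xₖ Aₖ)⁻¹ (∑ₖ Xₖ Aₖ) v`. -/
theorem hasRealization_of_isRational {R : MatFun m n} (hR : IsHyp R)
    (h : ∀ i j, IsRational (coeffs (R i j))) : HasRealization R := by
  obtain ⟨ℓ, u, A, v, c, hu, hc⟩ := exists_common_linear_system
    (r := fun ij : Fin m × Fin n => coeffs (R ij.1 ij.2)) fun ij => h ij.1 ij.2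
  let E : Fin (n * ℓ) ≃ Fin n × Fin ℓ := finProdFinEquiv.symm
  let A' : Fin 3 → Matrix (Fin (n * ℓ)) (Fin (n * ℓ)) ℍ[ℝ] := fun k => Matrix.of fun x y =>
    if (E x).1 = (E y).1 then A k (E x).2 (E y).2 else 0
  let B' : Fin 3 → Matrix (Fin (n * ℓ)) (Fin n) ℍ[ℝ] := fun k => Matrix.of fun x j =>
    if (E x).1 = j then ∑ b, A k (E x).2 b * v b else 0
  let C' : Matrix (Fin m) (Fin (n * ℓ)) ℍ[ℝ] := Matrix.of fun i x => c (i, (E x).1) (E x).2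
  let D' : Matrix (Fin m) (Fin n) ℍ[ℝ] := Matrix.of fun i j => ∑ a, c (i, j) a * v a
  let Y : Matrix (Fin (n * ℓ)) (Fin n) (MvPowerSeries (Fin 3) ℍ[ℝ]) := Matrix.of fun x j =>
    if (E x).1 = j then u (E x).2 - C (v (E x).2) else 0
  have hY : (1 - linMat A') * Y = linMat B' := by
    ext1 x j
    rw [Matrix.sub_mul, Matrix.one_mul, Matrix.sub_apply, sub_eq_iff_eq_add, Matrix.mul_apply,
      ← E.symm.sum_comp, Fintype.sum_prod_type, Finset.sum_eq_single (E x).1]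
    · simp only [Y, A', B', linMat, Matrix.of_apply, Equiv.apply_symm_apply, if_true]
      split_ifs with hxj
      · rw [hu, add_sub_cancel_left]
        simp only [mul_sub, Finset.sum_sub_distrib]
        have : ∑ k, X k * C (∑ b, A k (E x).2 b * v b) =
            ∑ b, (∑ k, X k * C (A k (E x).2 b)) * C (v b) := by
          simp only [map_sum, map_mul, Finset.mul_sum, Finset.sum_mul, mul_assoc]
          exact Finset.sum_comm
        rw [this]
        abel
      · simp
    · intro j' _ hj'
      refine Finset.sum_eq_zero fun a _ => ?_
      simp [linMat, A', hj'.symm]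
    · simp
  obtain ⟨W, hW⟩ := exists_isCKInverse A'
  obtain ⟨hWh, -, hW2⟩ := (isCKInverse_iff A' W).1 hW
  refine ⟨n * ℓ, A', B', C', D', W, hW, (germEq_realization_iff hR B' C' D' hWh).2 ?_⟩
  have hWY : coeffsMat W * linMat B' = Y := by
    rw [← hY, ← Matrix.mul_assoc, hW2, Matrix.one_mul]
  rw [Matrix.mul_assoc, hWY]
  ext1 i j
  have hij : coeffsMat R i j = ∑ a, C (c (i, j) a) * u a := hc (i, j)
  rw [hij, Matrix.add_apply, Matrix.mul_apply, ← E.symm.sum_comp, Fintype.sum_prod_type,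
    Finset.sum_eq_single j]
  · simp [C', D', Y, mul_sub, Finset.sum_sub_distrib]
  · intro j' _ hj'
    refine Finset.sum_eq_zero fun a _ => ?_
    simp [Y, hj']
  · simp

end Hyperholomorphic

end

theorem mainTheorem1 (m n : ℕ) (R : Matrix (Fin m) (Fin n) (ℍ[ℝ] → ℍ[ℝ]))
    (hR : Hyperholomorphic.IsHyp R) :
    (∀ i j, R i j ∈ Hyperholomorphic.RatQ) ↔ Hyperholomorphic.HasRealization R :=
  ⟨fun h => Hyperholomorphic.hasRealization_of_isRational hR fun i j =>
    (h i j _ Hyperholomorphic.isInversionClosedSubring_isRational).2,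
    Hyperholomorphic.mem_RatQ_of_hasRealization hR⟩
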